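/- All digraphs are finite, without loops and without parallel arcs (2-cycles are allowed). An in-tree rooted in a vertex $s$ is a digraph $T$ whose underlying undirected graph is connected and in which $s$ has out-degree $0$ and every other vertex has out-degree $1$; a digraph $D$ has an in-branching if it has a spanning subdigraph that is an in-tree rooted in some vertex of $D$. For a vertex set $U$, $D[U]$ denotes the subdigraph of $D$ induced by $U$, and $\delta^+(D[U])\ge 1$ means that every vertex of $D[U]$ has out-degree at least $1$ in $D[U]$ (which holds vacuously if $U=\emptyset$). The $(B^-,\delta^+\ge 1)$-$[k_1,k_2]$-partition problem is the following decision problem, with parameter $k=\max\{k_1,k_2\}$. Input: a digraph $D=(V,A)$ and natural numbers $k_1,k_2\ge 0$. Question: is there a partition of $V$ into two disjoint sets $V_1,V_2$ (with $V_1\cup V_2=V$) such that $D[V_1]$ has an in-branching, $\delta^+(D[V_2])\ge 1$, and $|V_i|\ge k_i$ for $i=1,2$? Then the $(B^-,\delta^+\ge 1)$-$[k_1,k_2]$-partition problem is fixed-parameter tractable: there are an algorithm (a program of a unit-cost random access machine with addition and subtraction), a computable function $f:\mathbb{N}\to\mathbb{N}$ and a constant $c$ such that the algorithm answers the question correctly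 for every input $(D,k_1,k_2)$ after at most $f(k)\cdot N^c$ steps, where $N=|V|^2+3$ is the length of the input, which lists the numbers $|V|,k_1,k_2$ and the entries of the adjacency matrix of $D$. This holds under each of the two conventions for $V_1=\emptyset$ (relevant only if $k_1=0$): when it is not allowed, since an in-branching has a root, and when it is allowed. -/

import Mathlib

namespace InBranchingPartition

/-! ### Digraphs: induced subdigraphs, out-degrees, in-branchings -/

section Digraphs

variable {V : Type*}

/-- The subdigraph `D[U]` of `D` induced by the vertex set `U`. -/
def induced (D : Digraph V) (U : Set V) : Digraph U where
  Adj a b := D.Adj a b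

/-- The out-degree of `v` in `D` (used for finite vertex sets only). -/
noncomputable def outDegree (D : Digraph V) (v : V) : ℕ :=
  {w | D.Adj v w}.ncard

/-- `δ⁺(D) ≥ d`: every vertex has out-degree at least `d` (vacuous if there is no vertex). -/
def MinOutDegreeAtLeast (D : Digraph V) (d : ℕ) : Prop :=
  ∀ v, d ≤ outDegree D v

/-- `T` is an in-tree rooted in `s`: its underlying undirected graph is connected, the root `s` has
out-degree `0`, and every other vertex has out-degree `1`. -/
def IsInTree (T : Digraph V) (s : V) : Prop :=
  T.toSimpleGraphInclusive.Connected ∧ outDegree T s = 0 ∧ ∀ u, u ≠ s → outDegree T u = 1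

/-- `D` has an in-branching: a spanning subdigraph that is an in-tree rooted in some vertex. -/
def HasInBranching (D : Digraph V) : Prop :=
  ∃ T : Digraph V, T ≤ D ∧ ∃ s, IsInTree T s

end Digraphs

/-! ### The machine model: random access machines with unit cost

The memory consists of registers `R₀, R₁, R₂, …`, each holding a natural number. The arithmetic is
restricted to addition and truncated subtraction, so that the unit cost measure is polynomially
related to Turing machine time. The input is a finite sequence of numbers in a separate read-only
array. -/

/-- The instructions; each of them takes one step. -/
inductive Instr where
  /-- `Rᵢ := c` -/
  | const (i c : ℕ)
  /-- `Rᵢ := Rⱼ + Rₖ` -/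
  | add (i j k : ℕ)
  /-- `Rᵢ := Rⱼ - Rₖ`, and `Rᵢ := 0` if `Rⱼ < Rₖ` -/
  | sub (i j k : ℕ)
  /-- `Rᵢ := R_(Rⱼ)` (indirect addressing) -/
  | load (i j : ℕ)
  /-- `R_(Rᵢ) := Rⱼ` (indirect addressing) -/
  | store (i j : ℕ)
  /-- `Rᵢ :=` the input entry at position `Rⱼ` (counted from `0`; the value is `0` past the end) -/
  | read (i j : ℕ)
  /-- if `Rᵢ = 0`, then continue with the instruction at position `l` of the program -/
  | jumpZero (i l : ℕ)

/-- A program is a finite list of instructions, at positions `0, 1, 2, …`. -/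
abbrev Program := List Instr

/-- A configuration: the position of the next instruction and the contents of the registers. -/
structure Config where
  pc : ℕ
  mem : ℕ → ℕ

/-- The effect of a single instruction. -/
def Instr.exec (input : List ℕ) (c : Config) : Instr → Config
  | .const i a => ⟨c.pc + 1, Function.update c.mem i a⟩
  | .add i j k => ⟨c.pc + 1, Function.update c.mem i (c.mem j + c.mem k)⟩
  | .sub i j k => ⟨c.pc + 1, Function.update c.mem i (c.mem j - c.mem k)⟩
  | .load i j => ⟨c.pc + 1, Function.update c.mem i (c.mem (c.mem j))⟩
  | .store i j => ⟨c.pc + 1, Function.update c.mem (c.mem i) (c.mem j)⟩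
  | .read i j => ⟨c.pc + 1, Function.update c.mem i (input.getD (c.mem j) 0)⟩
  | .jumpZero i l => ⟨if c.mem i = 0 then l else c.pc + 1, c.mem⟩

/-- One step of the machine. It has halted, and its configuration no longer changes, when there is
no instruction at the current position. -/
def step (P : Program) (input : List ℕ) (c : Config) : Config :=
  match P[c.pc]? with
  | some instr => instr.exec input c
  | none => c

/-- At the start, `R₀` holds the length of the input and all other registers hold `0`. -/
def initial (input : List ℕ) : Config :=
  ⟨0, Function.update (fun _ => 0) 0 input.length⟩

/-- On the given input, `P` halts after at most `t` steps with the value `a` in `R₀`. -/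
def OutputsWithin (P : Program) (input : List ℕ) (t a : ℕ) : Prop :=
  P.length ≤ ((step P input)^[t] (initial input)).pc ∧
    ((step P input)^[t] (initial input)).mem 0 = a

/-! ### Parameterized decision problems and fixed-parameter tractability -/

/-- A parameterized decision problem: its instances, their encoding as inputs of the machine,
the parameter of an instance, and the yes-instances. -/
structure ParameterizedProblem where
  Instance : Type
  encode : Instance → List ℕ
  param : Instance → ℕ
  IsYes : Instance → Prop

/-- Fixed-parameter tractability: for a computable `f` and a constant `c`, one program decides
every instance `x` of size `n` and parameter `k` in at most `f k * n ^ c` steps, with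
answer `1` for "yes" and `0` for "no". The size is the length of the encoding, and the constant
hidden in the `O`-notation is absorbed by `f`. -/
def ParameterizedProblem.IsFPT (Q : ParameterizedProblem) : Prop :=
  ∃ (P : Program) (f : ℕ → ℕ) (c : ℕ), Computable f ∧ ∀ x : Q.Instance,
    (Q.IsYes x → OutputsWithin P (Q.encode x) (f (Q.param x) * (Q.encode x).length ^ c) 1) ∧
    (¬ Q.IsYes x → OutputsWithin P (Q.encode x) (f (Q.param x) * (Q.encode x).length ^ c) 0)

/-! ### The partition problem -/

/-- An instance `(D, k₁, k₂)`: a finite digraph without loops (and without parallel arcs), with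
vertices `0, …, n - 1`, and two natural numbers. -/
structure Inst where
  n : ℕ
  D : Digraph (Fin n)
  loopless : ∀ v, ¬ D.Adj v v
  k₁ : ℕ
  k₂ : ℕ

open Classical in
/-- The encoding `n, k₁, k₂` followed by the `n * n` entries of the adjacency matrix, row by row. -/
noncomputable def Inst.encode (x : Inst) : List ℕ :=
  [x.n, x.k₁, x.k₂] ++ (List.finRange x.n).flatMap fun u =>
    (List.finRange x.n).map fun v => if x.D.Adj u v then 1 else 0

/-- The problem: is there a 2-partition `(V₁, V₂)` of the vertex set such that `D[V₁]` has an
in-branching, `δ⁺(D[V₂]) ≥ 1`, and `|Vᵢ| ≥ kᵢ` for `i = 1, 2`? The parameter is `max k₁ k₂`.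
As an in-branching has a root, `V₁` is nonempty here, even for `k₁ = 0`. -/
noncomputable def partitionProblem : ParameterizedProblem where
  Instance := Inst
  encode := Inst.encode
  param x := max x.k₁ x.k₂
  IsYes x := ∃ V₁ V₂ : Finset (Fin x.n), Disjoint V₁ V₂ ∧ V₁ ∪ V₂ = Finset.univ ∧
    HasInBranching (induced x.D (V₁ : Set (Fin x.n))) ∧
    MinOutDegreeAtLeast (induced x.D (V₂ : Set (Fin x.n))) 1 ∧
    x.k₁ ≤ V₁.card ∧ x.k₂ ≤ V₂.card

/-- The same problem under the convention that `V₁ = ∅` is allowed too (which matters only for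
`k₁ = 0`). -/
noncomputable def partitionProblemAllowingEmpty : ParameterizedProblem where
  Instance := Inst
  encode := Inst.encode
  param x := max x.k₁ x.k₂
  IsYes x := ∃ V₁ V₂ : Finset (Fin x.n), Disjoint V₁ V₂ ∧ V₁ ∪ V₂ = Finset.univ ∧
    (V₁ = ∅ ∨ HasInBranching (induced x.D (V₁ : Set (Fin x.n)))) ∧
    MinOutDegreeAtLeast (induced x.D (V₂ : Set (Fin x.n))) 1 ∧
    x.k₁ ≤ V₁.card ∧ x.k₂ ≤ V₂.card

end InBranchingPartition

namespace InBranchingPartition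

/-! Call a vertex set live if each of its vertices has an out-neighbour inside it. Fix a root `s`,
and assume that every other vertex has an out-arc in `D`, as any solution with root `s` requires.
Then a set `T` in which every vertex reaches `s`, together with a disjoint live set `U`, always
extends to a partition: the first part takes all vertices that reach `s` around `U`, and an out-arc
of a remaining vertex outside `U` cannot enter it (`exists_partition`). So it is enough to find an
in-tree on at least `k₁` vertices whose complement has a largest live subset (`liveCore`) with at
least `k₂` vertices.

The tree is grown from `{s}` by `k₁ - 1` attachments. A candidate is an in-neighbour of the tree
whose attachment leaves a live core of size `k₂`. There may be many candidates, but branching over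
the first `g = 4 * (k₁ - 1) + 2 * k₂ + 1` of them suffices (`exists_grow`). If there are at most
`g`, a vertex of the desired tree is among them. If there are more, some of the first `g` can be
attached simultaneously, as many as are still needed, and any one of these is a safe choice. This
leaves at most `g ^ (k₁ - 1)` sequences for each root.

The simultaneous attachment is the combinatorial core. By `exists_live_avoiding_many`, if each
vertex of a set `K` with at least `4 * r` elements is avoided by some nonempty live set, then one
nonempty live set avoids `r` elements of `K`. Otherwise a shortest closed walk, measured by entries
into `K`, is so long that some layer of vertices newly reached in `K` is a single vertex `v`; a live
set avoiding `v` cannot cross this layer, and so it misses many elements of `K` on one side.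
`exists_deletable_subset` passes from nonempty live sets to those of size at least `k`.

The search is then written in a small language of sums and bounded loops with a verified compiler to
the machine. Loops are bounded by registers holding `n` or numbers that depend only on the
parameter, and the bodies leave these registers unchanged, so the cost is polynomial in their
contents (`Cmd.polyCost`). -/

/-- A set in which every vertex has an out-neighbour. -/
def IsLive {V : Type*} (R : V → V → Prop) (Y : Finset V) : Prop :=
  ∀ x ∈ Y, ∃ y ∈ Y, R x y

theorem IsLive.union {V : Type*} [DecidableEq V] {R : V → V → Prop} {Y Z : Finset V}
    (hY : IsLive R Y) (hZ : IsLive R Z) : IsLive R (Y ∪ Z) := by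
  intro x hx
  rcases Finset.mem_union.1 hx with h | h
  · obtain ⟨y, hy, hr⟩ := hY x h
    exact ⟨y, Finset.mem_union_left _ hy, hr⟩
  · obtain ⟨y, hy, hr⟩ := hZ x h
    exact ⟨y, Finset.mem_union_right _ hy, hr⟩

/-! ### Walks graded by their entries into a set, and live sets that avoid many vertices -/

/-- `Level R K c j x`: there is a walk from `c` to `x` with at most `j` steps into `K`. -/
inductive Level {V : Type*} (R : V → V → Prop) (K : Finset V) (c : V) : ℕ → V → Prop
  | base (j : ℕ) : Level R K c j c
  | stepOut {j : ℕ} {x y : V} : Level R K c j x → R x y → y ∉ K → Level R K c j y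
  | stepIn {j : ℕ} {x y : V} : Level R K c j x → R x y → Level R K c (j + 1) y

section Levels

variable {V : Type*} {R : V → V → Prop} {K : Finset V} {c : V}

theorem Level.succ {j : ℕ} {x : V} (h : Level R K c j x) : Level R K c (j + 1) x := by
  induction h with
  | base j => exact .base _
  | stepOut _ hr hk ih => exact .stepOut ih hr hk
  | stepIn _ hr ih => exact .stepIn ih hr

/-- Closure carries every further step of a walk, so the levels stop growing for good once one of
them is closed under arcs. -/
theorem Level.of_closed {j : ℕ} (hc : ∀ x y, Level R K c j x → R x y → Level R K c j y)
    {i : ℕ} {x : V} (h : Level R K c i x) : Level R K c j x := by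
  induction h with
  | base => exact .base _
  | stepOut _ hr _ ih => exact hc _ _ ih hr
  | stepIn _ hr ih => exact hc _ _ ih hr

/-- `P` is the vertex set of the walk, in which only the last vertex may lack a successor; an arc
from `x` back to `c` makes it live. The `1` in `j + 1` pays for `c`, which may lie in `K`. -/
theorem Level.exists_walk [DecidableEq V] {j : ℕ} {x : V} (h : Level R K c j x) :
    ∃ P : Finset V, c ∈ P ∧ x ∈ P ∧ (P ∩ K).card ≤ j + 1 ∧
      ∀ y ∈ P, y ≠ x → ∃ z ∈ P, R y z := by
  induction h with
  | base j =>
    refine ⟨{c}, by simp, by simp, ?_, by simp⟩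
    exact (Finset.card_le_card Finset.inter_subset_left).trans (by simp)
  | @stepOut j x y _ hr hk ih =>
    obtain ⟨P, hc, hx, hcard, hP⟩ := ih
    refine ⟨insert y P, by simp [hc], by simp, ?_, ?_⟩
    · rwa [Finset.insert_inter_of_notMem hk]
    · intro u hu huy
      by_cases hux : u = x
      · exact ⟨y, by simp, hux ▸ hr⟩
      · obtain ⟨z, hz, h⟩ := hP u (Finset.mem_of_mem_insert_of_ne hu huy) hux
        exact ⟨z, by simp [hz], h⟩
  | @stepIn j x y _ hr ih =>
    obtain ⟨P, hc, hx, hcard, hP⟩ := ih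
    refine ⟨insert y P, by simp [hc], by simp, ?_, ?_⟩
    · calc (insert y P ∩ K).card ≤ (insert y (P ∩ K)).card := by
            apply Finset.card_le_card
            intro z; simp; tauto
        _ ≤ (P ∩ K).card + 1 := Finset.card_insert_le _ _
        _ ≤ _ := by omega
    · intro u hu huy
      by_cases hux : u = x
      · exact ⟨y, by simp, hux ▸ hr⟩
      · obtain ⟨z, hz, h⟩ := hP u (Finset.mem_of_mem_insert_of_ne hu huy) hux
        exact ⟨z, by simp [hz], h⟩

end Levels

/-- A minimal nonempty live set is strongly connected: a vertex of it is reachable from itself. -/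
theorem exists_level_return {V : Type*} [DecidableEq V] {R : V → V → Prop} {K U : Finset V} {c : V}
    (hU : IsLive R U) (hc : c ∈ U)
    (hmin : ∀ Y ⊆ U, Y.Nonempty → IsLive R Y → Y = U) : ∃ j x, Level R K c j x ∧ R x c := by
  classical
  -- The vertices of `U` reached from `c` by at least one arc form a nonempty live set, which by
  -- minimality contains `c`.
  let Y := U.filter fun y => ∃ j x, Level R K c j x ∧ R x y
  have hY : Y = U := by
    apply hmin _ (Finset.filter_subset _ _)
    · obtain ⟨y, hy, hr⟩ := hU c hc
      exact ⟨y, Finset.mem_filter.2 ⟨hy, 0, c, .base 0, hr⟩⟩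
    · intro y hy
      obtain ⟨hyU, j, x, hl, hr⟩ := Finset.mem_filter.1 hy
      obtain ⟨z, hz, hyz⟩ := hU y hyU
      exact ⟨z, Finset.mem_filter.2 ⟨hz, j + 1, y, .stepIn hl hr, hyz⟩, hyz⟩
  exact (Finset.mem_filter.1 (hY.symm ▸ hc : c ∈ Y)).2

/-- If each of sufficiently many vertices is avoided by a nonempty live set, then a nonempty live
set avoids many of them at once. -/
theorem exists_live_avoiding_many {V : Type*} [Fintype V] [DecidableEq V] (R : V → V → Prop)
    (K : Finset V) (r : ℕ) (hK : 4 * r ≤ K.card) (hK0 : K.Nonempty)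
    (havoid : ∀ v ∈ K, ∃ Y : Finset V, Y.Nonempty ∧ IsLive R Y ∧ v ∉ Y) :
    ∃ Y : Finset V, Y.Nonempty ∧ IsLive R Y ∧ r ≤ (K \ Y).card := by
  classical
  by_contra! hno
  -- By the negated conclusion, a nonempty live set misses fewer than `r` vertices of `K`.
  have hcount : ∀ Y : Finset V, Y.Nonempty → IsLive R Y → K.card + 1 ≤ (Y ∩ K).card + r := by
    intro Y h1 h2
    have h3 := hno Y h1 h2
    have h4 := Finset.card_sdiff_add_card_inter K Y
    rw [Finset.inter_comm] at h4
    omega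
  obtain ⟨v₀, hv₀⟩ := hK0
  obtain ⟨Y₀, hY₀n, hY₀l, -⟩ := havoid v₀ hv₀
  obtain ⟨U, hU, hUmin⟩ := Finset.exists_min_image
    (Finset.univ.filter fun Y : Finset V => Y.Nonempty ∧ IsLive R Y) Finset.card
    ⟨Y₀, by simp [hY₀n, hY₀l]⟩
  simp only [Finset.mem_filter, Finset.mem_univ, true_and] at hU hUmin
  have hr : 1 ≤ r := by
    have := hno Y₀ hY₀n hY₀l; omega
  obtain ⟨c, hc⟩ : (U ∩ K).Nonempty := by
    rw [← Finset.card_pos]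
    have := hcount U hU.1 hU.2
    omega
  rw [Finset.mem_inter] at hc
  have hret : ∃ j x, Level R K c j x ∧ R x c := by
    apply exists_level_return hU.2 hc.1
    intro Y hYU hYn hYl
    exact Finset.eq_of_subset_of_card_le hYU (hUmin Y ⟨hYn, hYl⟩)
  let J := Nat.find hret
  obtain ⟨x, hx, hxc⟩ : ∃ x, Level R K c J x ∧ R x c := Nat.find_spec hret
  have hJmin : ∀ j < J, ∀ x, Level R K c j x → ¬ R x c := by
    intro j hj x h1 h2
    exact Nat.find_min hret hj ⟨x, h1, h2⟩
  -- A closed walk through `c` has a live vertex set with at most `J + 1` vertices in `K`. With `4 *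
  -- r ≤ K.card`, this gives `3 * r ≤ J`.
  have hJ : K.card ≤ J + r := by
    obtain ⟨P, hcP, hxP, hcard, hP⟩ := hx.exists_walk
    have := hcount P ⟨c, hcP⟩ (fun y hy => by
      by_cases hyx : y = x
      · exact ⟨c, hcP, hyx ▸ hxc⟩
      · exact hP y hy hyx)
    omega
  let A : ℕ → Finset V := fun j => K.filter fun y => Level R K c j y
  have hmem : ∀ j y, y ∈ A j ↔ y ∈ K ∧ Level R K c j y := fun j y => by simp [A]
  have hstep : ∀ j y z, Level R K c j y → R y z → Level R K c j z ∨ z ∈ A (j + 1) := by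
    intro j y z h1 h2
    by_cases hz : z ∈ K
    · exact Or.inr ((hmem _ _).2 ⟨hz, .stepIn h1 h2⟩)
    · exact Or.inl (.stepOut h1 h2 hz)
  have hsub : ∀ j, A j ⊆ A (j + 1) := by
    intro j y hy
    rw [hmem] at hy ⊢
    exact ⟨hy.1, hy.2.succ⟩
  -- A level without new vertices of `K` would be closed, hence contain `x`, and `c` could be closed
  -- up with fewer than `J` entries.
  have hgrow : ∀ j < J, (A j).card + 1 ≤ (A (j + 1)).card := by
    intro j hj
    by_contra hlt
    have heq : A j = A (j + 1) := Finset.eq_of_subset_of_card_le (hsub j) (by omega)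
    have hcl : ∀ y z, Level R K c j y → R y z → Level R K c j z := by
      intro y z h1 h2
      rcases hstep j y z h1 h2 with h | h
      · exact h
      · rw [← heq, hmem] at h
        exact h.2
    exact hJmin j hj x (hx.of_closed hcl) hxc
  have h0 : 1 ≤ (A 0).card := Finset.card_pos.2 ⟨c, (hmem _ _).2 ⟨hc.2, .base 0⟩⟩
  have hgrow' : ∀ i d, i + d ≤ J → (A i).card + d ≤ (A (i + d)).card := by
    intro i d
    induction d with
    | zero => simp
    | succ d ih =>
      intro h
      have h1 := ih (by omega)
      have h2 := hgrow (i + d) (by omega)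
      rw [← add_assoc i d 1]
      omega
  have hle : ∀ j, (A j).card ≤ K.card := fun j => Finset.card_le_card (Finset.filter_subset _ _)
  -- If all `r` steps from level `r` to level `2 * r` gained at least two vertices, then `A J` would
  -- have at least `1 + r + 2 * r + (J - 2 * r) = J + r + 1` elements, more than `K` has.
  obtain ⟨i, hi1, hi2, hi⟩ : ∃ i, r ≤ i ∧ i < 2 * r ∧ (A (i + 1)).card = (A i).card + 1 := by
    by_contra! hne
    have hdouble : ∀ d ≤ r, (A r).card + 2 * d ≤ (A (r + d)).card := by
      intro d
      induction d with
      | zero => simp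
      | succ d ih =>
        intro h
        have h1 := ih (by omega)
        have h2 := hgrow (r + d) (by omega)
        have h3 := hne (r + d) (by omega) (by omega)
        rw [← add_assoc]
        omega
    have h1 := hdouble r le_rfl
    have h2 := hgrow' 0 r (by omega)
    have h3 := hgrow' (r + r) (J - (r + r)) (by omega)
    have h4 := hle (r + r + (J - (r + r)))
    rw [zero_add] at h2
    omega
  obtain ⟨v, hv⟩ : ∃ v, A (i + 1) \ A i = {v} := by
    rw [← Finset.card_eq_one, Finset.card_sdiff_of_subset (hsub i)]
    omega
  have hvA : v ∈ A (i + 1) \ A i := by simp [hv]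
  rw [Finset.mem_sdiff] at hvA
  obtain ⟨Y, hYn, hYl, hvY⟩ := havoid v ((hmem _ _).1 hvA.1).1
  -- Every arc that leaves level `i` ends in `v`, which `Y` avoids. So the part of `Y` in level `i`
  -- is itself live.
  have hY1 : IsLive R (Y.filter fun y => Level R K c i y) := by
    intro y hy
    rw [Finset.mem_filter] at hy
    obtain ⟨z, hz, hyz⟩ := hYl y hy.1
    refine ⟨z, Finset.mem_filter.2 ⟨hz, ?_⟩, hyz⟩
    rcases hstep i y z hy.2 hyz with h | h
    · exact h
    · by_contra hzi
      have : z ∈ A (i + 1) \ A i := Finset.mem_sdiff.2 ⟨h, fun h' => hzi ((hmem _ _).1 h').2⟩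
      rw [hv, Finset.mem_singleton] at this
      exact hvY (this ▸ hz)
  by_cases hY1n : (Y.filter fun y => Level R K c i y).Nonempty
  -- This part meets `K` only in `A i`, so it misses at least `J - i > r` vertices of `K`, which
  -- were added at later levels.
  · have h1 := hcount _ hY1n hY1
    have h2 : ((Y.filter fun y => Level R K c i y) ∩ K).card ≤ (A i).card := by
      apply Finset.card_le_card
      intro y hy
      rw [Finset.mem_inter, Finset.mem_filter] at hy
      exact (hmem _ _).2 ⟨hy.2, hy.1.2⟩
    have h3 := hgrow' i (J - i) (by omega)
    have h4 := hle (i + (J - i))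
    omega
  -- Here `Y` misses all of `A i`, which has at least `i + 1 > r` vertices.
  · have h1 := hcount Y hYn hYl
    have h2 : (Y ∩ K).card + (A i).card ≤ K.card := by
      rw [← Finset.card_union_of_disjoint]
      · apply Finset.card_le_card
        exact Finset.union_subset Finset.inter_subset_right (Finset.filter_subset _ _)
      · rw [Finset.disjoint_left]
        intro y hy hyA
        exact hY1n ⟨y, Finset.mem_filter.2 ⟨(Finset.mem_inter.1 hy).1, ((hmem _ _).1 hyA).2⟩⟩
    have h3 := hgrow' 0 i (by omega)
    rw [zero_add] at h3
    omega


/-! ### The largest live subset and the simultaneous deletion of vertices -/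

section Core

variable {V : Type*} [DecidableEq V] {R : V → V → Prop}

open Classical in
/-- The largest live subset of `U`. -/
noncomputable def liveCore (R : V → V → Prop) (U : Finset V) : Finset V :=
  U.filter fun v => ∃ Y ⊆ U, IsLive R Y ∧ v ∈ Y

theorem mem_liveCore {U : Finset V} {v : V} :
    v ∈ liveCore R U ↔ v ∈ U ∧ ∃ Y ⊆ U, IsLive R Y ∧ v ∈ Y := by
  classical
  simp [liveCore]

theorem liveCore_subset (U : Finset V) : liveCore R U ⊆ U := fun _ hv => (mem_liveCore.1 hv).1

theorem isLive_liveCore (U : Finset V) : IsLive R (liveCore R U) := by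
  intro v hv
  obtain ⟨-, Y, hYU, hY, hvY⟩ := mem_liveCore.1 hv
  obtain ⟨w, hw, hr⟩ := hY v hvY
  exact ⟨w, mem_liveCore.2 ⟨hYU hw, Y, hYU, hY, hw⟩, hr⟩

theorem IsLive.subset_liveCore {U Y : Finset V} (hY : IsLive R Y) (hYU : Y ⊆ U) :
    Y ⊆ liveCore R U :=
  fun _ hv => mem_liveCore.2 ⟨hYU hv, Y, hYU, hY, hv⟩

theorem liveCore_mono {U W : Finset V} (h : U ⊆ W) : liveCore R U ⊆ liveCore R W :=
  (isLive_liveCore U).subset_liveCore ((liveCore_subset U).trans h)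

/-- If deleting any one of sufficiently many vertices leaves a large live set, then some `r` of them
can be deleted at once. -/
theorem exists_deletable_subset [Fintype V] (R : V → V → Prop) (U K : Finset V) (r k : ℕ)
    (hK : 4 * r + 2 * k + 1 ≤ K.card)
    (hdel : ∀ v ∈ K, k ≤ (liveCore R (U.erase v)).card) :
    ∃ S ⊆ K, S.card = r ∧ k ≤ (liveCore R (U \ S)).card := by
  classical
  have main : ∃ Y ⊆ U, IsLive R Y ∧ k ≤ Y.card ∧ r ≤ (K \ Y).card := by
    -- A live set with at most `2 * k` vertices misses at least `4 * r + 1` vertices of `K`, for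
    -- reasons of size alone.
    by_cases hsmall : ∃ Y ⊆ U, IsLive R Y ∧ k ≤ Y.card ∧ Y.card ≤ 2 * k
    · obtain ⟨Y, hYU, hY, hk, hk2⟩ := hsmall
      refine ⟨Y, hYU, hY, hk, ?_⟩
      have := Finset.le_card_sdiff Y K
      omega
    push Not at hsmall
    have hk0 : 0 < k := by
      by_contra h
      have := hsmall ∅ (by simp) (by simp [IsLive]) (by omega)
      simp at this
    -- Now no live set has between `k` and `2 * k` vertices. The union of `Z` with a live set of at
    -- most `k` vertices stays within `2 * k`, hence below `k`, and so by maximality it is `Z`.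
    obtain ⟨Z, hZ, hZmax⟩ := Finset.exists_max_image
      (U.powerset.filter fun Y => IsLive R Y ∧ Y.card < k) Finset.card
      ⟨∅, Finset.mem_filter.2 ⟨by simp, by simp [IsLive], by simpa using hk0⟩⟩
    simp only [Finset.mem_filter, Finset.mem_powerset] at hZ hZmax
    obtain ⟨hZU, hZl, hZk⟩ := hZ
    have habs : ∀ Y ⊆ U, IsLive R Y → Y.card ≤ k → Y ⊆ Z := by
      intro Y hYU hY hYk
      have hYZ : (Y ∪ Z).card ≤ 2 * k := (Finset.card_union_le _ _).trans (by omega)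
      have hlt : (Y ∪ Z).card < k := by
        by_contra h
        have := hsmall (Y ∪ Z) (Finset.union_subset hYU hZU) (hY.union hZl) (by omega)
        omega
      have hle := hZmax (Y ∪ Z) ⟨Finset.union_subset hYU hZU, hY.union hZl, hlt⟩
      rw [Finset.eq_of_subset_of_card_le Finset.subset_union_right hle]
      exact Finset.subset_union_left
    -- Adding one in-neighbour keeps `Z` live and raises its size to at most `k`, so `Z` absorbs
    -- that vertex.
    have hclosed : ∀ x ∈ U, ∀ z ∈ Z, R x z → x ∈ Z := by
      intro x hx z hz hr
      refine habs (insert x Z) (Finset.insert_subset hx hZU) ?_ ?_ (Finset.mem_insert_self _ _)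
      · intro y hy
        rcases Finset.mem_insert.1 hy with rfl | hy
        · exact ⟨z, Finset.mem_insert_of_mem hz, hr⟩
        · obtain ⟨w, hw, h⟩ := hZl y hy
          exact ⟨w, Finset.mem_insert_of_mem hw, h⟩
      · exact (Finset.card_insert_le _ _).trans (by omega)
    -- Outside `Z`, being nonempty replaces having at least `k` vertices. No arc of `U` enters `Z`
    -- from outside, so removing `Z` from a live subset of `U` leaves a live set. Conversely, a
    -- nonempty live set disjoint from `Z` has more than `k` vertices, since otherwise `Z` would
    -- absorb it.
    let R' : V → V → Prop := fun x y => R x y ∧ x ∈ U \ Z ∧ y ∈ U \ Z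
    have hR' : ∀ Y, IsLive R' Y → Y ⊆ U \ Z ∧ IsLive R Y := by
      intro Y hY
      constructor
      · intro x hx
        obtain ⟨y, -, h⟩ := hY x hx
        exact h.2.1
      · intro x hx
        obtain ⟨y, hy, h⟩ := hY x hx
        exact ⟨y, hy, h.1⟩
    have hKZ := Finset.le_card_sdiff Z K
    obtain ⟨Y, hYn, hY, hYr⟩ := exists_live_avoiding_many R' (K \ Z) r (by omega)
      (Finset.card_pos.1 (by omega)) (by
        intro v hv
        rw [Finset.mem_sdiff] at hv
        refine ⟨liveCore R (U.erase v) \ Z, ?_, ?_, ?_⟩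
        · rw [← Finset.card_pos]
          have h1 := Finset.le_card_sdiff Z (liveCore R (U.erase v))
          have h2 := hdel v hv.1
          omega
        · intro x hx
          rw [Finset.mem_sdiff] at hx
          have hxU := Finset.mem_of_mem_erase (liveCore_subset _ hx.1)
          obtain ⟨y, hy, hr⟩ := isLive_liveCore _ x hx.1
          have hyU := Finset.mem_of_mem_erase (liveCore_subset _ hy)
          have hyZ : y ∉ Z := fun h => hx.2 (hclosed x hxU y h hr)
          exact ⟨y, Finset.mem_sdiff.2 ⟨hy, hyZ⟩, hr, Finset.mem_sdiff.2 ⟨hxU, hx.2⟩,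
            Finset.mem_sdiff.2 ⟨hyU, hyZ⟩⟩
        · intro h
          exact Finset.notMem_erase v U (liveCore_subset _ (Finset.mem_sdiff.1 h).1))
    obtain ⟨hYU, hYl⟩ := hR' Y hY
    refine ⟨Y, hYU.trans Finset.sdiff_subset, hYl, ?_, hYr.trans (Finset.card_le_card ?_)⟩
    · by_contra h
      obtain ⟨y, hy⟩ := hYn
      exact (Finset.mem_sdiff.1 (hYU hy)).2
        (habs Y (hYU.trans Finset.sdiff_subset) hYl (by omega) hy)
    · exact Finset.sdiff_subset_sdiff Finset.sdiff_subset le_rfl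
  obtain ⟨Y, hYU, hY, hk, hr⟩ := main
  obtain ⟨S, hS, hSr⟩ := Finset.exists_subset_card_eq hr
  refine ⟨S, hS.trans Finset.sdiff_subset, hSr, hk.trans (Finset.card_le_card ?_)⟩
  apply hY.subset_liveCore
  intro y hy
  exact Finset.mem_sdiff.2 ⟨hYU hy, fun h => (Finset.mem_sdiff.1 (hS h)).2 hy⟩

end Core

/-! ### Ranks in a finite set -/

section Rank

variable {V : Type*} [LinearOrder V]

/-- The number of elements of `C` below `v`. -/
def rankIn (C : Finset V) (v : V) : ℕ := (C.filter (· < v)).card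

theorem rankIn_lt_rankIn {C : Finset V} {u v : V} (hu : u ∈ C) (huv : u < v) :
    rankIn C u < rankIn C v := by
  apply Finset.card_lt_card
  refine ⟨fun w hw => ?_, fun h => ?_⟩
  · rw [Finset.mem_filter] at hw ⊢
    exact ⟨hw.1, hw.2.trans huv⟩
  · have := h (Finset.mem_filter.2 ⟨hu, huv⟩)
    simp at this

theorem rankIn_injOn (C : Finset V) : Set.InjOn (rankIn C) C := by
  intro u hu v hv h
  rcases lt_trichotomy u v with h' | h' | h'
  · exact absurd h (rankIn_lt_rankIn hu h').ne
  · exact h'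
  · exact absurd h (rankIn_lt_rankIn hv h').ne'

theorem rankIn_lt_card {C : Finset V} {v : V} (hv : v ∈ C) : rankIn C v < C.card := by
  apply Finset.card_lt_card
  refine ⟨Finset.filter_subset _ _, fun h => ?_⟩
  have := h hv
  simp at this

/-- Ranks are injective on `C` with values below `C.card`, so every such value is attained. -/
theorem le_card_filter_rankIn_lt {C : Finset V} {g : ℕ} (hg : g ≤ C.card) :
    g ≤ (C.filter fun v => rankIn C v < g).card := by
  have hsurj : ∀ i ∈ Finset.range C.card, ∃ v ∈ C, i = rankIn C v := by
    intro i hi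
    obtain ⟨v, hv, h⟩ := Finset.surj_on_of_inj_on_of_card_le (s := C) (t := Finset.range C.card)
      (fun v _ => rankIn C v) (fun v hv => Finset.mem_range.2 (rankIn_lt_card hv))
      (fun u v hu hv h => rankIn_injOn C hu hv h) (by simp) i hi
    exact ⟨v, hv, h⟩
  have : Finset.range g ⊆ (C.filter fun v => rankIn C v < g).image (rankIn C) := by
    intro i hi
    rw [Finset.mem_range] at hi
    obtain ⟨v, hv, rfl⟩ := hsurj i (Finset.mem_range.2 (by omega))
    exact Finset.mem_image_of_mem _ (Finset.mem_filter.2 ⟨hv, hi⟩)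
  simpa using (Finset.card_le_card this).trans Finset.card_image_le

end Rank

/-! ### Growing an in-tree -/

section Grow

variable {V : Type*}

/-- `T` contains `s`, and every vertex of `T` has a path to `s` within `T`. -/
def ReachesRoot (R : V → V → Prop) (T : Finset V) (s : V) : Prop :=
  s ∈ T ∧ ∀ v ∈ T, Relation.ReflTransGen (fun a b => R a b ∧ a ∈ T ∧ b ∈ T) v s

theorem ReachesRoot.insert [DecidableEq V] {R : V → V → Prop} {T : Finset V} {s v w : V}
    (h : ReachesRoot R T s) (hw : w ∈ T) (hvw : R v w) : ReachesRoot R (insert v T) s := by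
  refine ⟨Finset.mem_insert_of_mem h.1, fun u hu => ?_⟩
  have hT : ∀ u ∈ T, Relation.ReflTransGen
      (fun a b => R a b ∧ a ∈ Insert.insert v T ∧ b ∈ Insert.insert v T) u s := fun u hu =>
    Relation.ReflTransGen.mono (fun a b hab => ⟨hab.1, Finset.mem_insert_of_mem hab.2.1,
      Finset.mem_insert_of_mem hab.2.2⟩) _ _ (h.2 u hu)
  rcases Finset.mem_insert.1 hu with rfl | hu
  · exact Relation.ReflTransGen.head ⟨hvw, Finset.mem_insert_self _ _,
      Finset.mem_insert_of_mem hw⟩ (hT w hw)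
  · exact hT u hu

theorem ReachesRoot.union [DecidableEq V] {R : V → V → Prop} {T S : Finset V} {s : V}
    (h : ReachesRoot R T s) (hS : ∀ v ∈ S, ∃ w ∈ T, R v w) : ReachesRoot R (T ∪ S) s := by
  induction S using Finset.induction_on with
  | empty => simpa using h
  | insert v S _ ih =>
    obtain ⟨w, hw, hvw⟩ := hS v (Finset.mem_insert_self _ _)
    rw [Finset.union_insert]
    exact (ih fun u hu => hS u (Finset.mem_insert_of_mem hu)).insert
      (Finset.mem_union_left _ hw) hvw

/-- A proper subset of an in-tree that contains the root has an in-neighbour in the in-tree. -/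
theorem ReachesRoot.exists_boundary {R : V → V → Prop} {T W : Finset V} {s : V}
    (h : ReachesRoot R W s) (hs : s ∈ T) (hW : ¬ W ⊆ T) :
    ∃ v ∈ W, v ∉ T ∧ ∃ w ∈ T, R v w := by
  obtain ⟨x, hxW, hxT⟩ := Finset.not_subset.1 hW
  have := h.2 x hxW
  induction this using Relation.ReflTransGen.head_induction_on with
  | refl => exact absurd hs hxT
  | @head a b hab _ ih =>
    by_cases hb : b ∈ T
    · exact ⟨a, hxW, hxT, b, hb, hab.1⟩
    · exact ih hab.2.2 hb

variable [Fintype V] [LinearOrder V]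

open Classical in
/-- The vertices that may be attached to `T`, leaving a live set with at least `k` vertices. -/
noncomputable def candidates (R : V → V → Prop) (k : ℕ) (T : Finset V) : Finset V :=
  Finset.univ.filter fun v =>
    v ∉ T ∧ (∃ w ∈ T, R v w) ∧ k ≤ (liveCore R (insert v T)ᶜ).card

theorem mem_candidates {R : V → V → Prop} {k : ℕ} {T : Finset V} {v : V} :
    v ∈ candidates R k T ↔
      v ∉ T ∧ (∃ w ∈ T, R v w) ∧ k ≤ (liveCore R (insert v T)ᶜ).card := by
  classical
  simp [candidates]

/-- Attach the candidate of rank `b` to `T`, if it exists. -/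
noncomputable def attach (R : V → V → Prop) (k b : ℕ) (T : Finset V) : Finset V :=
  T ∪ (candidates R k T).filter fun v => rankIn (candidates R k T) v = b

/-- Attach `r` vertices to `T` in turn, as given by the digits of `q` in base `g`. -/
noncomputable def grow (R : V → V → Prop) (k g : ℕ) : ℕ → Finset V → ℕ → Finset V
  | 0, T, _ => T
  | r + 1, T, q => grow R k g r (attach R k (q % g) T) (q / g)

theorem ReachesRoot.grow {R : V → V → Prop} {k g : ℕ} {s : V} (r : ℕ) {T : Finset V} (q : ℕ)
    (h : ReachesRoot R T s) : ReachesRoot R (grow R k g r T q) s := by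
  induction r generalizing T q with
  | zero => exact h
  | succ r ih =>
    apply ih
    apply h.union
    intro v hv
    exact (mem_candidates.1 (Finset.mem_filter.1 hv).1).2.1

theorem attach_eq_insert {R : V → V → Prop} {k : ℕ} {T : Finset V} {v : V}
    (hv : v ∈ candidates R k T) : attach R k (rankIn (candidates R k T) v) T = insert v T := by
  ext u
  simp only [attach, Finset.mem_union, Finset.mem_filter, Finset.mem_insert]
  constructor
  · rintro (h | ⟨h1, h2⟩)
    · exact Or.inr h
    · exact Or.inl (rankIn_injOn _ h1 hv h2)
  · rintro (rfl | h)
    · exact Or.inr ⟨hv, rfl⟩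
    · exact Or.inl h

/-- The search is complete: it finds an in-tree if there is one. -/
theorem exists_grow {R : V → V → Prop} {k g r₀ : ℕ} (hg : 4 * r₀ + 2 * k + 1 ≤ g) {s : V} (r : ℕ)
    (hr : r ≤ r₀) {T W : Finset V} (hT : ReachesRoot R T s) (hW : ReachesRoot R W s) (hTW : T ⊆ W)
    (hcard : T.card + r ≤ W.card) (hk : k ≤ (liveCore R Wᶜ).card) :
    ∃ q < g ^ r, T.card + r ≤ (grow R k g r T q).card ∧
      k ≤ (liveCore R (grow R k g r T q)ᶜ).card := by
  induction r generalizing T W with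
  | zero =>
    refine ⟨0, by simp, by simp [grow], hk.trans (Finset.card_le_card (liveCore_mono ?_))⟩
    exact Finset.compl_subset_compl.2 hTW
  | succ r ih =>
    -- `W` certifies that `T` still extends to a large enough tree. The choice of `v` may replace
    -- the certificate by another one, `W'`. The base `g` depends on the fixed `r₀`, not on the
    -- decreasing `r`.
    obtain ⟨v, W', hv, hvg, hW', hvW', hcard', hk'⟩ : ∃ v W', v ∈ candidates R k T ∧
        rankIn (candidates R k T) v < g ∧ ReachesRoot R W' s ∧ insert v T ⊆ W' ∧
        T.card + (r + 1) ≤ W'.card ∧ k ≤ (liveCore R W'ᶜ).card := by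
      by_cases hC : (candidates R k T).card ≤ g
      · obtain ⟨v, hvW, hvT, hadj⟩ := hW.exists_boundary hT.1 (fun h => by
          have := Finset.card_le_card h
          omega)
        have hins : insert v T ⊆ W := Finset.insert_subset hvW hTW
        have hv : v ∈ candidates R k T := by
          refine mem_candidates.2 ⟨hvT, hadj, hk.trans ?_⟩
          exact Finset.card_le_card (liveCore_mono (Finset.compl_subset_compl.2 hins))
        exact ⟨v, W, hv, (rankIn_lt_card hv).trans_le hC, hW, hins, hcard, hk⟩
      -- With more than `g` candidates, `r + 1` of the first `g` can be attached at once. All of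
      -- them point into `T`, so `T ∪ S` is a new certificate and any element of `S` may come first.
      · have hCT : ∀ v ∈ candidates R k T, v ∉ T ∧ (∃ w ∈ T, R v w) ∧
            k ≤ (liveCore R (insert v T)ᶜ).card := fun v hv => mem_candidates.1 hv
        obtain ⟨S, hS, hSr, hSk⟩ := exists_deletable_subset R Tᶜ
          ((candidates R k T).filter fun v => rankIn (candidates R k T) v < g) (r + 1) k
          (by
            have := le_card_filter_rankIn_lt (C := candidates R k T) (g := g) (by omega)
            omega)
          (fun v hv => by
            have := (hCT v (Finset.mem_filter.1 hv).1).2.2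
            rwa [Finset.compl_insert] at this)
        have hSC : ∀ v ∈ S, v ∈ candidates R k T := fun v hv => (Finset.mem_filter.1 (hS hv)).1
        obtain ⟨v, hv⟩ : S.Nonempty := Finset.card_pos.1 (by omega)
        refine ⟨v, T ∪ S, hSC v hv, (Finset.mem_filter.1 (hS hv)).2,
          hT.union fun u hu => (hCT u (hSC u hu)).2.1, ?_, ?_, ?_⟩
        · exact Finset.insert_subset (Finset.mem_union_right _ hv) Finset.subset_union_left
        · rw [Finset.card_union_of_disjoint, hSr]
          rw [Finset.disjoint_left]
          exact fun u hu huS => (hCT u (hSC u huS)).1 hu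
        · rwa [Finset.compl_union, ← Finset.sdiff_eq_inter_compl]
    obtain ⟨hvT, ⟨w, hw, hvw⟩, -⟩ := mem_candidates.1 hv
    have hcardv : (insert v T).card = T.card + 1 := Finset.card_insert_of_notMem hvT
    obtain ⟨q, hq, h1, h2⟩ := ih (by omega) (hT.insert hw hvw) hW' hvW' (by omega) hk'
    have hmod : (rankIn (candidates R k T) v + g * q) % g = rankIn (candidates R k T) v := by
      rw [Nat.add_mul_mod_self_left, Nat.mod_eq_of_lt hvg]
    have hdiv : (rankIn (candidates R k T) v + g * q) / g = q := by
      rw [Nat.add_mul_div_left _ _ (by omega), Nat.div_eq_of_lt hvg, zero_add]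
    -- The rank is the least significant digit, because `grow` consumes digits by `% g` and `/ g`.
    refine ⟨rankIn (candidates R k T) v + g * q, ?_, ?_, ?_⟩
    · calc rankIn (candidates R k T) v + g * q < g + g * q := by omega
        _ = g * (q + 1) := by ring
        _ ≤ g * g ^ r := Nat.mul_le_mul_left _ hq
        _ = g ^ (r + 1) := by ring
    · rw [InBranchingPartition.grow, hmod, hdiv, attach_eq_insert hv]
      omega
    · rwa [InBranchingPartition.grow, hmod, hdiv, attach_eq_insert hv]

end Grow


/-! ### Reformulation of the problem by reachability, live sets and the search -/

section Characterization

theorem outDegree_pos {V : Type*} [Finite V] {D : Digraph V} {v : V} :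
    1 ≤ outDegree D v ↔ ∃ w, D.Adj v w := by
  rw [outDegree, Nat.succ_le_iff, Set.ncard_pos]
  rfl

theorem minOutDegree_induced_iff {V : Type*} [Finite V] {D : Digraph V} {U : Finset V} :
    MinOutDegreeAtLeast (induced D (U : Set V)) 1 ↔ IsLive D.Adj U := by
  constructor
  · intro h x hx
    obtain ⟨⟨w, hw⟩, hadj⟩ := outDegree_pos.1 (h ⟨x, hx⟩)
    exact ⟨w, hw, hadj⟩
  · rintro h ⟨x, hx⟩
    obtain ⟨w, hw, hadj⟩ := h x hx
    exact outDegree_pos.2 ⟨⟨w, hw⟩, hadj⟩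

/-- In an in-tree, every vertex has a path to the root. -/
theorem IsInTree.reaches {V : Type*} [Finite V] {T : Digraph V} {s : V} (h : IsInTree T s) (v : V) :
    Relation.ReflTransGen T.Adj v s := by
  obtain ⟨hc, h0, h1⟩ := h
  have hs : ∀ w, ¬ T.Adj s w := by
    intro w hw
    have := outDegree_pos.2 ⟨w, hw⟩
    omega
  obtain ⟨p⟩ := hc.preconnected s v
  -- Reaching `s` passes along edges in both directions: for an arc from `a` to `b`, the path from
  -- `a` to `s` must begin with it, as it is the only out-arc of `a`.
  have key : ∀ a b, T.toSimpleGraphInclusive.Adj a b → Relation.ReflTransGen T.Adj a s →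
      Relation.ReflTransGen T.Adj b s := by
    intro a b hab ha
    have hab' : T.Adj a b ∨ T.Adj b a := by
      have := hab
      simp only [Digraph.toSimpleGraphInclusive, SimpleGraph.fromRel_adj] at this
      exact this.2
    rcases hab' with h | h
    · rcases Relation.ReflTransGen.cases_head ha with rfl | ⟨c, hac, hcs⟩
      · exact absurd h (hs b)
      · have has : a ≠ s := fun has => hs b (has ▸ h)
        obtain ⟨d, hd⟩ := Set.ncard_eq_one.1 (h1 a has)
        have hb : b ∈ {w | T.Adj a w} := h
        have hc : c ∈ {w | T.Adj a w} := hac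
        rw [hd, Set.mem_singleton_iff] at hb hc
        rwa [hb, ← hc]
    · exact Relation.ReflTransGen.head h ha
  clear h0 h1 hs
  have : ∀ {a b : V}, T.toSimpleGraphInclusive.Walk a b → Relation.ReflTransGen T.Adj a s →
      Relation.ReflTransGen T.Adj b s := by
    intro a b p
    induction p with
    | nil => exact id
    | cons hadj _ ih => exact fun h => ih (key _ _ hadj h)
  exact this p .refl

/-- A digraph in which every vertex reaches `s` has an in-branching rooted in `s`. -/
theorem hasInBranching_of_reaches {V : Type*} [Finite V] {D : Digraph V} {s : V}
    (h : ∀ v, Relation.ReflTransGen D.Adj v s) : HasInBranching D := by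
  classical
  -- Walks to `s` are given with their length so that `Nat.find` defines the distance. Each vertex
  -- other than `s` then chooses as its parent an out-neighbour at smaller distance.
  have hdist : ∀ v, ∃ k, ∃ f : ℕ → V, f 0 = v ∧ f k = s ∧ ∀ i < k, D.Adj (f i) (f (i + 1)) := by
    intro v
    induction h v using Relation.ReflTransGen.head_induction_on with
    | refl => exact ⟨0, fun _ => s, rfl, rfl, by simp⟩
    | @head a b hab _ ih =>
      obtain ⟨k, f, h0, hk, hf⟩ := ih
      refine ⟨k + 1, fun i => Nat.casesOn i a f, rfl, hk, ?_⟩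
      rintro (_ | i) hi
      · simpa [h0] using hab
      · exact hf i (by omega)
  let d : V → ℕ := fun v => Nat.find (hdist v)
  have hd : ∀ v, v ≠ s → ∃ w, D.Adj v w ∧ d w < d v := by
    intro v hv
    obtain ⟨f, h0, hk, hf⟩ := Nat.find_spec (hdist v)
    have hpos : 0 < d v := by
      rw [Nat.pos_iff_ne_zero]
      intro h
      apply hv
      rw [← h0, ← hk]
      exact congrArg f h.symm
    refine ⟨f 1, h0 ▸ hf 0 hpos, ?_⟩
    have : d (f 1) ≤ d v - 1 := by
      apply Nat.find_min'
      refine ⟨fun i => f (i + 1), rfl, ?_, fun i hi => hf (i + 1) ?_⟩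
      · rw [← hk]
        exact congrArg f (Nat.sub_add_cancel hpos)
      · change i + 1 < d v
        omega
    exact this.trans_lt (Nat.sub_lt hpos one_pos)
  choose! p hp using hd
  let T : Digraph V := ⟨fun v w => v ≠ s ∧ w = p v⟩
  have hreach : ∀ k v, d v ≤ k → T.toSimpleGraphInclusive.Reachable v s := by
    intro k
    induction k with
    | zero =>
      intro v hv
      by_cases hvs : v = s
      · subst hvs; rfl
      · have := (hp v hvs).2
        omega
    | succ k ih =>
      intro v hv
      by_cases hvs : v = s
      · subst hvs; rfl
      · have h1 := (hp v hvs).2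
        have hadj : T.toSimpleGraphInclusive.Adj v (p v) := by
          simp only [Digraph.toSimpleGraphInclusive, SimpleGraph.fromRel_adj]
          refine ⟨fun h => ?_, Or.inl ⟨hvs, rfl⟩⟩
          rw [← h] at h1
          omega
        exact hadj.reachable.trans (ih _ (by omega))
  refine ⟨T, ?_, s, ?_, ?_, ?_⟩
  · intro v w hvw
    obtain ⟨hvs, rfl⟩ := hvw
    exact (hp v hvs).1
  · have : Nonempty V := ⟨s⟩
    exact ⟨fun u v => (hreach _ u le_rfl).trans (hreach _ v le_rfl).symm⟩
  · by_contra h0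
    obtain ⟨w, hw⟩ := outDegree_pos.1 (Nat.one_le_iff_ne_zero.2 h0)
    exact hw.1 rfl
  · intro u hu
    rw [outDegree, Set.ncard_eq_one]
    refine ⟨p u, ?_⟩
    ext w
    exact ⟨fun h => h.2, fun h => ⟨hu, h⟩⟩

theorem hasInBranching_induced_iff {V : Type*} [Finite V] {D : Digraph V} {U : Finset V} :
    HasInBranching (induced D (U : Set V)) ↔ ∃ s, ReachesRoot D.Adj U s := by
  constructor
  · rintro ⟨T, hTD, s, hT⟩
    refine ⟨s, s.2, fun v hv => ?_⟩
    exact Relation.ReflTransGen.lift Subtype.val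
      (fun a b hab => ⟨hTD hab, a.2, b.2⟩) _ _ (hT.reaches ⟨v, hv⟩)
  · rintro ⟨s, hs, h⟩
    refine hasInBranching_of_reaches (s := ⟨s, hs⟩) ?_
    rintro ⟨v, hv⟩
    have := h v hv
    induction this using Relation.ReflTransGen.head_induction_on with
    | refl => exact .refl
    | @head a b hab _ ih =>
      exact Relation.ReflTransGen.head (b := (⟨b, hab.2.2⟩ : (U : Set V))) hab.1 (ih hab.2.2)

/-- Disjoint parts of the two kinds extend to a partition of the whole vertex set. -/
theorem exists_partition {V : Type*} [Fintype V] [DecidableEq V] {R : V → V → Prop}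
    {T U : Finset V} {s : V} (hT : ReachesRoot R T s) (hU : IsLive R U) (hTU : Disjoint T U)
    (hout : ∀ v, v ≠ s → ∃ w, R v w) :
    ∃ W, T ⊆ W ∧ U ⊆ Wᶜ ∧ ReachesRoot R W s ∧ IsLive R Wᶜ := by
  classical
  -- The first part consists of all vertices that reach `s` without meeting `U`. It contains `T`,
  -- which is disjoint from `U`.
  let Q : V → V → Prop := fun a b => R a b ∧ a ∉ U ∧ b ∉ U
  let W := Finset.univ.filter fun v => Relation.ReflTransGen Q v s
  have hsU : s ∉ U := Finset.disjoint_left.1 hTU hT.1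
  have hmem : ∀ v, v ∈ W ↔ Relation.ReflTransGen Q v s := fun v => by simp [W]
  have hWU : ∀ v, v ∈ W → v ∉ U := by
    intro v hv
    rcases Relation.ReflTransGen.cases_head ((hmem v).1 hv) with rfl | ⟨c, hc, -⟩
    · exact hsU
    · exact hc.2.1
  refine ⟨W, ?_, ?_, ⟨(hmem s).2 .refl, ?_⟩, ?_⟩
  · intro v hv
    rw [hmem]
    exact Relation.ReflTransGen.mono (fun a b hab => ⟨hab.1, Finset.disjoint_left.1 hTU hab.2.1,
      Finset.disjoint_left.1 hTU hab.2.2⟩) _ _ (hT.2 v hv)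
  · intro v hv
    exact Finset.mem_compl.2 fun h => hWU v h hv
  · intro v hv
    rw [hmem] at hv
    induction hv using Relation.ReflTransGen.head_induction_on with
    | refl => exact .refl
    | head hab hbs ih =>
      exact .head ⟨hab.1, (hmem _).2 (.head hab hbs), (hmem _).2 hbs⟩ ih
  · intro x hx
    rw [Finset.mem_compl] at hx
    by_cases hxU : x ∈ U
    · obtain ⟨y, hy, hxy⟩ := hU x hxU
      exact ⟨y, Finset.mem_compl.2 fun h => hWU y h hy, hxy⟩
    -- The head `y` cannot lie in `W`, since then `x`, which is outside `U`, would also reach `s`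
    -- around `U`.
    · obtain ⟨y, hxy⟩ := hout x fun h => hx ((hmem x).2 (h ▸ .refl))
      refine ⟨y, Finset.mem_compl.2 fun h => hx ?_, hxy⟩
      exact (hmem x).2 (.head ⟨hxy, hxU, hWU y h⟩ ((hmem y).1 h))

/-- The outcome of the search over all roots and all sequences of choices. -/
def SearchSucceeds {V : Type*} [Fintype V] [LinearOrder V] (R : V → V → Prop) (r k g : ℕ) : Prop :=
  ∃ s, (∀ v, v ≠ s → ∃ w, R v w) ∧ ∃ q < g ^ r,
    r < (grow R k g r {s} q).card ∧ k ≤ (liveCore R (grow R k g r {s} q)ᶜ).card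

/-- A successful search is completed by `exists_partition`; conversely, `V₁` is the initial
certificate for `exists_grow`. Truncation in `k₁ - 1` is harmless, as the tree always contains its
root. -/
theorem searchSucceeds_iff {V : Type*} [Fintype V] [LinearOrder V] {D : Digraph V} (k₁ k₂ : ℕ) :
    SearchSucceeds D.Adj (k₁ - 1) k₂ (4 * (k₁ - 1) + 2 * k₂ + 1) ↔
    ∃ V₁ V₂ : Finset V, Disjoint V₁ V₂ ∧ V₁ ∪ V₂ = Finset.univ ∧
      HasInBranching (induced D (V₁ : Set V)) ∧
      MinOutDegreeAtLeast (induced D (V₂ : Set V)) 1 ∧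
      k₁ ≤ V₁.card ∧ k₂ ≤ V₂.card := by
  simp only [hasInBranching_induced_iff, minOutDegree_induced_iff]
  have hroot : ∀ s, ReachesRoot D.Adj {s} s := fun s =>
    ⟨by simp, fun v hv => (Finset.mem_singleton.1 hv) ▸ .refl⟩
  constructor
  · rintro ⟨s, hout, q, -, hcard, hk⟩
    obtain ⟨W, hTW, hUW, hW, hl⟩ := exists_partition ((hroot s).grow (k₁ - 1) q)
      (isLive_liveCore (R := D.Adj) _)
      (disjoint_compl_right.mono_right (liveCore_subset _)) hout
    refine ⟨W, Wᶜ, disjoint_compl_right, Finset.union_compl W, ⟨s, hW⟩, hl, ?_,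
      hk.trans (Finset.card_le_card hUW)⟩
    have := Finset.card_le_card hTW
    omega
  · rintro ⟨W, U, hdisj, hun, ⟨s, hW⟩, hl, h1, h2⟩
    have hU : U ⊆ Wᶜ := fun v hv => Finset.mem_compl.2 (Finset.disjoint_right.1 hdisj hv)
    have hpos : 0 < W.card := Finset.card_pos.2 ⟨s, hW.1⟩
    refine ⟨s, fun v hvs => ?_, ?_⟩
    · rcases Finset.mem_union.1 (hun ▸ Finset.mem_univ v : v ∈ W ∪ U) with hv | hv
      · rcases Relation.ReflTransGen.cases_head (hW.2 v hv) with h | ⟨c, hc, -⟩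
        · exact absurd h hvs
        · exact ⟨c, hc.1⟩
      · obtain ⟨w, -, hw⟩ := hl v hv
        exact ⟨w, hw⟩
    · obtain ⟨q, hq, h3, h4⟩ := exists_grow (R := D.Adj) (k := k₂) le_rfl (k₁ - 1) le_rfl (hroot s)
        hW (by simpa using hW.1) (by rw [Finset.card_singleton]; omega)
        (h2.trans (Finset.card_le_card (hl.subset_liveCore hU)))
      rw [Finset.card_singleton] at h3
      exact ⟨q, hq, by omega, h4⟩

theorem isYes_iff (x : Inst) : partitionProblem.IsYes x ↔
    SearchSucceeds x.D.Adj (x.k₁ - 1) x.k₂ (4 * (x.k₁ - 1) + 2 * x.k₂ + 1) :=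
  (searchSucceeds_iff _ _).symm

/-- An empty `V₁` forces `k₁ = 0` and `V₂ = V`, so only the size and the out-degrees of `D` remain
to be tested. -/
theorem isYes_allowingEmpty_iff (x : Inst) : partitionProblemAllowingEmpty.IsYes x ↔
    SearchSucceeds x.D.Adj (x.k₁ - 1) x.k₂ (4 * (x.k₁ - 1) + 2 * x.k₂ + 1) ∨
      (x.k₁ = 0 ∧ x.k₂ ≤ x.n ∧ ∀ v, ∃ w, x.D.Adj v w) := by
  rw [searchSucceeds_iff]
  constructor
  · rintro ⟨W, U, hdisj, hun, rfl | hW, hl, h1, h2⟩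
    · right
      rw [Finset.empty_union] at hun
      subst hun
      refine ⟨by simpa using h1, by simpa using h2, fun v => ?_⟩
      obtain ⟨w, -, hw⟩ := minOutDegree_induced_iff.1 hl v (Finset.mem_univ v)
      exact ⟨w, hw⟩
    · exact Or.inl ⟨W, U, hdisj, hun, hW, hl, h1, h2⟩
  · rintro (⟨W, U, hdisj, hun, hW, h⟩ | ⟨h1, h2, h3⟩)
    · exact ⟨W, U, hdisj, hun, Or.inr hW, h⟩
    · refine ⟨∅, Finset.univ, by simp, by simp, Or.inl rfl, ?_, by simp [h1], by simpa using h2⟩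
      rw [minOutDegree_induced_iff]
      intro v _
      obtain ⟨w, hw⟩ := h3 v
      exact ⟨w, Finset.mem_univ w, hw⟩

end Characterization


/-! ### Execution of straight-line code -/

/-- The program `P` contains the instructions `l` from position `p` on. -/
def CodeAt (P : Program) (p : ℕ) (l : List Instr) : Prop := l <+: P.drop p

theorem CodeAt.append {P : Program} {p : ℕ} {a b : List Instr} (h : CodeAt P p (a ++ b)) :
    CodeAt P p a ∧ CodeAt P (p + a.length) b := by
  obtain ⟨t, ht⟩ := h
  refine ⟨⟨b ++ t, by rw [← ht, List.append_assoc]⟩, ⟨t, ?_⟩⟩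
  rw [← List.drop_drop, ← ht, List.append_assoc, List.drop_left]

theorem CodeAt.head {P : Program} {p : ℕ} {i : Instr} {l : List Instr} (h : CodeAt P p (i :: l)) :
    P[p]? = some i := by
  obtain ⟨t, ht⟩ := h
  have : (P.drop p)[0]? = some i := by rw [← ht]; simp
  simpa using this

/-- From `c` the machine reaches `c'` in at most `t` steps. -/
def Within (P : Program) (input : List ℕ) (t : ℕ) (c c' : Config) : Prop :=
  ∃ t' ≤ t, (step P input)^[t'] c = c'

section Within

variable {P : Program} {input : List ℕ}

theorem Within.trans {t₁ t₂ : ℕ} {c₁ c₂ c₃ : Config} (h₁ : Within P input t₁ c₁ c₂)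
    (h₂ : Within P input t₂ c₂ c₃) : Within P input (t₁ + t₂) c₁ c₃ := by
  obtain ⟨t, ht, rfl⟩ := h₁
  obtain ⟨t', ht', rfl⟩ := h₂
  exact ⟨t' + t, by omega, Function.iterate_add_apply _ _ _ _⟩

theorem Within.mono {t₁ t₂ : ℕ} {c₁ c₂ : Config} (h : Within P input t₁ c₁ c₂) (ht : t₁ ≤ t₂) :
    Within P input t₂ c₁ c₂ := by
  obtain ⟨t, h1, h2⟩ := h
  exact ⟨t, h1.trans ht, h2⟩

theorem Within.weaken {t₁ t₂ p₁ p₂ : ℕ} {c : Config} {m : ℕ → ℕ} (h : Within P input t₁ c ⟨p₁, m⟩)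
    (ht : t₁ ≤ t₂) (hp : p₁ = p₂) : Within P input t₂ c ⟨p₂, m⟩ :=
  hp ▸ h.mono ht

/-- The memory after a list of instructions without jumps. -/
def effect (input : List ℕ) (l : List Instr) (m : ℕ → ℕ) : ℕ → ℕ :=
  l.foldl (fun m i => (i.exec input ⟨0, m⟩).mem) m

/-- The instruction is not a jump. -/
def Instr.IsPlain : Instr → Prop
  | .jumpZero _ _ => False
  | _ => True

theorem exec_of_isPlain {i : Instr} (h : i.IsPlain) (p : ℕ) (m : ℕ → ℕ) :
    i.exec input ⟨p, m⟩ = ⟨p + 1, (i.exec input ⟨0, m⟩).mem⟩ := by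
  cases i <;> first | rfl | exact h.elim

theorem within_effect {l : List Instr} {p : ℕ} (m : ℕ → ℕ) (hl : ∀ i ∈ l, i.IsPlain)
    (h : CodeAt P p l) : Within P input l.length ⟨p, m⟩ ⟨p + l.length, effect input l m⟩ := by
  induction l generalizing p m with
  | nil => exact ⟨0, le_rfl, rfl⟩
  | cons i l ih =>
    have h1 : Within P input 1 ⟨p, m⟩ ⟨p + 1, (i.exec input ⟨0, m⟩).mem⟩ := by
      refine ⟨1, le_rfl, ?_⟩
      rw [Function.iterate_one, step, h.head]
      exact exec_of_isPlain (hl i (by simp)) p m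
    have h2 := ih (i.exec input ⟨0, m⟩).mem (fun j hj => hl j (by simp [hj]))
      (CodeAt.append (a := [i]) h).2
    have h3 := h1.trans h2
    rw [List.length_singleton, add_assoc, add_comm 1] at h3
    exact h3.mono (by simp)

theorem within_jumpZero {i l p : ℕ} {t : List Instr} (m : ℕ → ℕ)
    (h : CodeAt P p (.jumpZero i l :: t)) :
    Within P input 1 ⟨p, m⟩ ⟨if m i = 0 then l else p + 1, m⟩ := by
  refine ⟨1, le_rfl, ?_⟩
  rw [Function.iterate_one, step, h.head]
  rfl

end Within

/-! ### A language of expressions and bounded loops -/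

/-- A state: registers and three arrays. -/
structure Store where
  reg : ℕ → ℕ
  arr : Fin 3 → ℕ → ℕ

namespace Store

/-- Assign a register. -/
def setReg (s : Store) (x v : ℕ) : Store := ⟨Function.update s.reg x v, s.arr⟩

/-- Assign an array entry. -/
def setArr (s : Store) (a : Fin 3) (i v : ℕ) : Store :=
  ⟨s.reg, Function.update s.arr a (Function.update (s.arr a) i v)⟩

@[simp] theorem setReg_arr (s : Store) (x v : ℕ) : (s.setReg x v).arr = s.arr := rfl

@[simp] theorem setArr_reg (s : Store) (a : Fin 3) (i v : ℕ) : (s.setArr a i v).reg = s.reg := rfl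

theorem setReg_reg (s : Store) (x v y : ℕ) :
    (s.setReg x v).reg y = if y = x then v else s.reg y := Function.update_apply _ _ _ _

theorem setArr_arr (s : Store) (a : Fin 3) (i v : ℕ) (b : Fin 3) (j : ℕ) :
    (s.setArr a i v).arr b j = if b = a ∧ j = i then v else s.arr b j := by
  by_cases hb : b = a
  · subst hb
    simp [setArr, Function.update_apply]
  · simp [setArr, hb]

@[simp] theorem setReg_setReg (s : Store) (x v w : ℕ) :
    (s.setReg x v).setReg x w = s.setReg x w := by
  simp [setReg]

@[simp] theorem setReg_self (s : Store) (x : ℕ) : s.setReg x (s.reg x) = s := by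
  simp [setReg]

end Store

/-- Expressions; `sum x e₁ e₂` is the sum of `e₂` over all `x < e₁`, where `x` is a register. -/
inductive Expr where
  | const (c : ℕ)
  | reg (x : ℕ)
  | add (e₁ e₂ : Expr)
  | sub (e₁ e₂ : Expr)
  | input (e : Expr)
  | get (a : Fin 3) (e : Expr)
  | ite (e e₁ e₂ : Expr)
  | sum (x : ℕ) (e₁ e₂ : Expr)

/-- The value of an expression. -/
def Expr.eval (inp : List ℕ) : Expr → Store → ℕ
  | .const c, _ => c
  | .reg x, s => s.reg x
  | .add e₁ e₂, s => e₁.eval inp s + e₂.eval inp s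
  | .sub e₁ e₂, s => e₁.eval inp s - e₂.eval inp s
  | .input e, s => inp.getD (e.eval inp s) 0
  | .get a e, s => s.arr a (e.eval inp s)
  | .ite e e₁ e₂, s => if e.eval inp s = 0 then e₂.eval inp s else e₁.eval inp s
  | .sum x e₁ e₂, s => ∑ i ∈ Finset.range (e₁.eval inp s), e₂.eval inp (s.setReg x i)

/-- The number of steps for the evaluation of an expression. -/
def Expr.cost (inp : List ℕ) : Expr → Store → ℕ
  | .const _, _ => 1
  | .reg _, _ => 2
  | .add e₁ e₂, s => e₁.cost inp s + e₂.cost inp s + 1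
  | .sub e₁ e₂, s => e₁.cost inp s + e₂.cost inp s + 1
  | .input e, s => e.cost inp s + 1
  | .get _ e, s => e.cost inp s + 6
  -- Both branches are charged although only one is executed; an upper bound is all that is needed.
  | .ite e e₁ e₂, s => e.cost inp s + (e₁.cost inp s + e₂.cost inp s) + 3
  -- Each round has `7` instructions besides the body: the test, five updates and the jump back. The
  -- `8` covers four for the set-up, the last test and three for the clean-up.
  | .sum x e₁ e₂, s => e₁.cost inp s +
      ∑ i ∈ Finset.range (e₁.eval inp s), (e₂.cost inp (s.setReg x i) + 7) + 8

/-- Commands; `loop x e c` executes `c` for all `x < e`. -/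
inductive Cmd where
  | assign (x : ℕ) (e : Expr)
  | store (a : Fin 3) (e₁ e₂ : Expr)
  | seq (c₁ c₂ : Cmd)
  | loop (x : ℕ) (e : Expr) (c : Cmd)

/-- `f (k - 1) (… (f 1 (f 0 s)))`. -/
def iter {α : Type*} (f : ℕ → α → α) : ℕ → α → α
  | 0, s => s
  | k + 1, s => f k (iter f k s)

/-- The effect of a command. -/
def Cmd.run (inp : List ℕ) : Cmd → Store → Store
  | .assign x e, s => s.setReg x (e.eval inp s)
  | .store a e₁ e₂, s => s.setArr a (e₁.eval inp s) (e₂.eval inp s)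
  | .seq c₁ c₂, s => c₂.run inp (c₁.run inp s)
  | .loop x e c, s => iter (fun i s => c.run inp (s.setReg x i)) (e.eval inp s) s

/-- The number of steps of a command. -/
def Cmd.cost (inp : List ℕ) : Cmd → Store → ℕ
  | .assign _ e, s => e.cost inp s + 2
  | .store _ e₁ e₂, s => e₁.cost inp s + e₂.cost inp s + 6
  | .seq c₁ c₂, s => c₁.cost inp s + c₂.cost inp (c₁.run inp s)
  | .loop x e c, s => e.cost inp s + ∑ i ∈ Finset.range (e.eval inp s),
      (c.cost inp ((iter (fun i s => c.run inp (s.setReg x i)) i s).setReg x i) + 8) + 2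

/-! ### Compilation -/

/-- The address of a register of a store. -/
def regAddr (x : ℕ) : ℕ := 8 * x

/-- The address of an auxiliary register. -/
def auxAddr (d : ℕ) : ℕ := 8 * d + 1

/-- The address of an array entry. -/
def arrAddr (a : Fin 3) (i : ℕ) : ℕ := 8 * i + (2 + a)

-- Registers, auxiliary registers and the three arrays occupy the residues `0`, `1` and `2` to `4`
-- modulo `8`, so their addresses never collide.
@[simp] theorem auxAddr_inj {d e : ℕ} : auxAddr d = auxAddr e ↔ d = e := by
  simp [auxAddr]

@[simp] theorem regAddr_inj {d e : ℕ} : regAddr d = regAddr e ↔ d = e := by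
  simp [regAddr]

@[simp] theorem regAddr_ne_auxAddr {x d : ℕ} : regAddr x ≠ auxAddr d := by
  simp only [regAddr, auxAddr]; omega

@[simp] theorem auxAddr_ne_regAddr {x d : ℕ} : auxAddr d ≠ regAddr x := by
  simp only [regAddr, auxAddr]; omega

@[simp] theorem arrAddr_ne_auxAddr {a : Fin 3} {i d : ℕ} : arrAddr a i ≠ auxAddr d := by
  simp only [arrAddr, auxAddr]; omega

@[simp] theorem auxAddr_ne_arrAddr {a : Fin 3} {i d : ℕ} : auxAddr d ≠ arrAddr a i := by
  simp only [arrAddr, auxAddr]; omega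

@[simp] theorem arrAddr_ne_regAddr {a : Fin 3} {i d : ℕ} : arrAddr a i ≠ regAddr d := by
  simp only [arrAddr, regAddr]; omega

@[simp] theorem regAddr_ne_arrAddr {a : Fin 3} {i d : ℕ} : regAddr d ≠ arrAddr a i := by
  simp only [arrAddr, regAddr]; omega

@[simp] theorem arrAddr_inj {a b : Fin 3} {i j : ℕ} : arrAddr a i = arrAddr b j ↔ a = b ∧ i = j := by
  simp only [arrAddr, Fin.ext_iff]; omega

/-- The memory `m` contains the store `s`. -/
structure Represents (m : ℕ → ℕ) (s : Store) : Prop where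
  reg : ∀ x, m (regAddr x) = s.reg x
  arr : ∀ a i, m (arrAddr a i) = s.arr a i

namespace Represents

variable {m : ℕ → ℕ} {s : Store}

theorem update_aux (h : Represents m s) (d v : ℕ) :
    Represents (Function.update m (auxAddr d) v) s :=
  ⟨fun x => by simp [h.reg], fun a i => by simp [h.arr]⟩

theorem update_reg (h : Represents m s) (x v : ℕ) :
    Represents (Function.update m (regAddr x) v) (s.setReg x v) :=
  ⟨fun y => by simp [Function.update_apply, Store.setReg_reg, h.reg], fun a i => by simp [h.arr]⟩

theorem update_arr (h : Represents m s) (a : Fin 3) (i v : ℕ) :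
    Represents (Function.update m (arrAddr a i) v) (s.setArr a i v) :=
  ⟨fun y => by simp [h.reg],
    fun b j => by simp [Function.update_apply, Store.setArr_arr, h.arr]⟩

end Represents

/-- Replaces the content `i` of an auxiliary register by the address of entry `i` of an array. -/
def addrCode (a : Fin 3) (d : ℕ) : List Instr :=
  -- Three doublings multiply the index by `8`.
  [.add (auxAddr d) (auxAddr d) (auxAddr d), .add (auxAddr d) (auxAddr d) (auxAddr d),
    .add (auxAddr d) (auxAddr d) (auxAddr d), .const (auxAddr (d + 1)) (2 + a),
    .add (auxAddr d) (auxAddr d) (auxAddr (d + 1))]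

/-- The machine code of an expression, to be placed at position `p`. It puts the value into the
auxiliary register `d` and leaves those below `d` unchanged. -/
def Expr.code : Expr → ℕ → ℕ → List Instr
  | .const c, d, _ => [.const (auxAddr d) c]
  | .reg x, d, _ => [.const (auxAddr d) 0, .add (auxAddr d) (auxAddr d) (regAddr x)]
  | .add e₁ e₂, d, p =>
    e₁.code d p ++ (e₂.code (d + 1) (p + (e₁.code d p).length) ++
      [.add (auxAddr d) (auxAddr d) (auxAddr (d + 1))])
  | .sub e₁ e₂, d, p =>
    e₁.code d p ++ (e₂.code (d + 1) (p + (e₁.code d p).length) ++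
      [.sub (auxAddr d) (auxAddr d) (auxAddr (d + 1))])
  | .input e, d, p => e.code d p ++ [.read (auxAddr d) (auxAddr d)]
  | .get a e, d, p => e.code d p ++ (addrCode a d ++ [.load (auxAddr d) (auxAddr d)])
  | .ite e e₁ e₂, d, p =>
    let c := e.code d p
    let q₁ := p + c.length + 1
    let c₁ := e₁.code d q₁
    let q₂ := q₁ + c₁.length + 2
    let c₂ := e₂.code d q₂
    -- A `jumpZero` on a register that has just been set to `0` serves as an unconditional jump.
    c ++ ([.jumpZero (auxAddr d) q₂] ++ (c₁ ++ ([.const (auxAddr (d + 1)) 0] ++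
      ([.jumpZero (auxAddr (d + 1)) (q₂ + c₂.length)] ++ c₂))))
  | .sum x e₁ e₂, d, p =>
    let c₁ := e₁.code d p
    let q := p + c₁.length + 4
    let c₂ := e₂.code (d + 3) (q + 1)
    -- Auxiliary register `d` counts down, `d + 1` accumulates, and `d + 2` saves the register `x`,
    -- which is restored at the end; so evaluation does not change the store.
    c₁ ++ ([.const (auxAddr (d + 1)) 0, .const (auxAddr (d + 2)) 0,
        .add (auxAddr (d + 2)) (auxAddr (d + 2)) (regAddr x), .const (regAddr x) 0] ++
      ([.jumpZero (auxAddr d) (q + 1 + c₂.length + 6)] ++ (c₂ ++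
        ([.add (auxAddr (d + 1)) (auxAddr (d + 1)) (auxAddr (d + 3)), .const (auxAddr (d + 3)) 1,
          .add (regAddr x) (regAddr x) (auxAddr (d + 3)),
          .sub (auxAddr d) (auxAddr d) (auxAddr (d + 3)), .const (auxAddr (d + 3)) 0] ++
        ([.jumpZero (auxAddr (d + 3)) q] ++
        [.const (auxAddr (d + 3)) 0, .add (auxAddr d) (auxAddr (d + 1)) (auxAddr (d + 3)),
          .add (regAddr x) (auxAddr (d + 2)) (auxAddr (d + 3))])))))

/-- The machine code of a command, to be placed at position `p`, which leaves the auxiliary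
registers below `d` unchanged. -/
def Cmd.code : Cmd → ℕ → ℕ → List Instr
  | .assign x e, d, p =>
    e.code d p ++ [.const (auxAddr (d + 1)) 0, .add (regAddr x) (auxAddr d) (auxAddr (d + 1))]
  | .store a e₁ e₂, d, p =>
    e₁.code d p ++ (addrCode a d ++ (e₂.code (d + 1) (p + (e₁.code d p).length + 5) ++
      [.store (auxAddr d) (auxAddr (d + 1))]))
  | .seq c₁ c₂, d, p => c₁.code d p ++ c₂.code d (p + (c₁.code d p).length)
  | .loop x e c, d, p =>
    let c₁ := e.code d p
    let q := p + c₁.length + 1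
    let c₂ := c.code (d + 2) (q + 3)
    -- Register `x` is reloaded from the counter `d + 1` in every round, so the body may overwrite
    -- it.
    c₁ ++ ([.const (auxAddr (d + 1)) 0] ++ ([.jumpZero (auxAddr d) (q + 3 + c₂.length + 5)] ++
      ([.const (auxAddr (d + 2)) 0, .add (regAddr x) (auxAddr (d + 1)) (auxAddr (d + 2))] ++ (c₂ ++
      ([.const (auxAddr (d + 2)) 1, .add (auxAddr (d + 1)) (auxAddr (d + 1)) (auxAddr (d + 2)),
        .sub (auxAddr d) (auxAddr d) (auxAddr (d + 2)), .const (auxAddr (d + 2)) 0] ++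
      [.jumpZero (auxAddr (d + 2)) q])))))

section Correctness

variable {P : Program} {inp : List ℕ}

theorem effect_addrCode (a : Fin 3) (d : ℕ) {m : ℕ → ℕ} {s : Store} (hm : Represents m s) :
    Represents (effect inp (addrCode a d) m) s ∧
      effect inp (addrCode a d) m (auxAddr d) = arrAddr a (m (auxAddr d)) ∧
      ∀ j < d, effect inp (addrCode a d) m (auxAddr j) = m (auxAddr j) := by
  simp only [effect, addrCode, List.foldl, Instr.exec]
  refine ⟨?_, ?_, ?_⟩
  · exact ((((hm.update_aux _ _).update_aux _ _).update_aux _ _).update_aux _ _).update_aux _ _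
  · simp [arrAddr]
    ring
  · intro j hj
    simp [hj.ne, (show j ≠ d + 1 by omega)]

theorem isPlain_addrCode (a : Fin 3) (d : ℕ) : ∀ i ∈ addrCode a d, i.IsPlain := by
  simp [addrCode, Instr.IsPlain]

/-- What the code of an expression achieves. -/
def Expr.CodeSpec (P : Program) (inp : List ℕ) (e : Expr) : Prop :=
  ∀ (d p : ℕ) (m : ℕ → ℕ) (s : Store), Represents m s → CodeAt P p (e.code d p) →
    ∃ m', Within P inp (e.cost inp s) ⟨p, m⟩ ⟨p + (e.code d p).length, m'⟩ ∧ Represents m' s ∧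
      m' (auxAddr d) = e.eval inp s ∧ ∀ j < d, m' (auxAddr j) = m (auxAddr j)

/-- Induction on the number `k` of remaining rounds, after `i` rounds. Adding the cost of the first
`i` rounds to both sides of the time bound avoids subtraction. -/
theorem Expr.sum_loop {e : Expr} (he : e.CodeSpec P inp) (x d q : ℕ) (s : Store)
    (l : List Instr) (hl : l = [.jumpZero (auxAddr d) (q + 1 + (e.code (d + 3) (q + 1)).length + 6)]
        ++ (e.code (d + 3) (q + 1) ++
        ([.add (auxAddr (d + 1)) (auxAddr (d + 1)) (auxAddr (d + 3)), .const (auxAddr (d + 3)) 1,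
          .add (regAddr x) (regAddr x) (auxAddr (d + 3)),
          .sub (auxAddr d) (auxAddr d) (auxAddr (d + 3)), .const (auxAddr (d + 3)) 0] ++
        [.jumpZero (auxAddr (d + 3)) q])))
    (hP : CodeAt P q l) (k : ℕ) : ∀ (i : ℕ) (m : ℕ → ℕ), Represents m (s.setReg x i) →
      m (auxAddr d) = k → m (auxAddr (d + 1)) = ∑ j ∈ Finset.range i, e.eval inp (s.setReg x j) →
      ∃ t m', Within P inp t ⟨q, m⟩ ⟨q + 1 + (e.code (d + 3) (q + 1)).length + 6, m'⟩ ∧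
        t + ∑ j ∈ Finset.range i, (e.cost inp (s.setReg x j) + 7) ≤
          1 + ∑ j ∈ Finset.range (i + k), (e.cost inp (s.setReg x j) + 7) ∧
        Represents m' (s.setReg x (i + k)) ∧
        m' (auxAddr (d + 1)) = ∑ j ∈ Finset.range (i + k), e.eval inp (s.setReg x j) ∧
        m' (auxAddr (d + 2)) = m (auxAddr (d + 2)) ∧ ∀ j < d, m' (auxAddr j) = m (auxAddr j) := by
  have hP' := hP
  rw [hl] at hP'
  obtain ⟨hA, hP'⟩ := hP'.append
  obtain ⟨hB, hP'⟩ := hP'.append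
  obtain ⟨hC, hD⟩ := hP'.append
  induction k with
  | zero =>
    intro i m hm hk hacc
    refine ⟨1, m, ?_, ?_, by simpa using hm, by simpa using hacc, rfl, fun _ _ => rfl⟩
    · simpa [hk] using within_jumpZero (input := inp) m hA
    · simp
  | succ k ih =>
    intro i m hm hk hacc
    have h1 := within_jumpZero (input := inp) m hA
    rw [if_neg (by omega)] at h1
    obtain ⟨m₁, h2, hm₁, hv, hlow⟩ := he (d + 3) (q + 1) m _ hm hB
    have h3 := within_effect (input := inp) m₁ (by simp [Instr.IsPlain]) hC
    set m₂ := effect inp [.add (auxAddr (d + 1)) (auxAddr (d + 1)) (auxAddr (d + 3)),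
      .const (auxAddr (d + 3)) 1, .add (regAddr x) (regAddr x) (auxAddr (d + 3)),
      .sub (auxAddr d) (auxAddr d) (auxAddr (d + 3)), .const (auxAddr (d + 3)) 0] m₁ with hm₂
    have h4 := within_jumpZero (input := inp) m₂ hD
    simp only [effect, List.foldl, Instr.exec] at hm₂
    have e0 : m₂ (auxAddr (d + 3)) = 0 := by simp [hm₂]
    have e1 : m₂ (auxAddr d) = k := by
      simp [hm₂, hlow d (by omega), hk]
    have e2 : m₂ (auxAddr (d + 1)) =
        ∑ j ∈ Finset.range (i + 1), e.eval inp (s.setReg x j) := by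
      simp [hm₂, hlow (d + 1) (by omega), hacc, hv, Finset.sum_range_succ]
    have e3 : m₂ (auxAddr (d + 2)) = m (auxAddr (d + 2)) := by
      simp [hm₂, hlow (d + 2) (by omega)]
    have e4 : ∀ j < d, m₂ (auxAddr j) = m (auxAddr j) := by
      intro j hj
      simp [hm₂, hlow j (by omega), hj.ne, (show j ≠ d + 1 by omega), (show j ≠ d + 3 by omega)]
    have e5 : Represents m₂ (s.setReg x (i + 1)) := by
      have := ((((hm₁.update_aux (d + 1) (m₁ (auxAddr (d + 1)) + m₁ (auxAddr (d + 3)))).update_aux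
        (d + 3) 1).update_reg x (i + 1)).update_aux d (m₁ (auxAddr d) - 1)).update_aux (d + 3) 0
      rw [Store.setReg_setReg] at this
      rw [hm₂]
      simpa [hm₁.reg, Store.setReg_reg] using this
    rw [if_pos e0] at h4
    obtain ⟨t, m₃, h5, ht, hm₃, f1, f2, f3⟩ := ih (i + 1) m₂ e5 e1 e2
    refine ⟨_, m₃, h1.trans (h2.trans (h3.trans (h4.trans h5))), ?_, ?_, ?_, f2.trans e3,
      fun j hj => (f3 j hj).trans (e4 j hj)⟩
    · rw [Finset.sum_range_succ] at ht
      rw [show i + (k + 1) = i + 1 + k by omega]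
      simp only [List.length_cons, List.length_nil]
      omega
    · rwa [show i + (k + 1) = i + 1 + k by omega]
    · rwa [show i + (k + 1) = i + 1 + k by omega]

theorem Expr.code_spec (e : Expr) : e.CodeSpec P inp := by
  induction e with
  | const c =>
    intro d p m s hm hP
    refine ⟨_, within_effect m (by simp [Expr.code, Instr.IsPlain]) hP, ?_, ?_, ?_⟩
    · exact hm.update_aux _ _
    · simp [effect, Expr.code, Instr.exec, Expr.eval]
    · intro j hj
      simp [effect, Expr.code, Instr.exec, hj.ne]
  | reg x =>
    intro d p m s hm hP
    refine ⟨_, within_effect m (by simp [Expr.code, Instr.IsPlain]) hP, ?_, ?_, ?_⟩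
    · exact (hm.update_aux _ _).update_aux _ _
    · simp [effect, Expr.code, Instr.exec, Expr.eval, hm.reg]
    · intro j hj
      simp [effect, Expr.code, Instr.exec, hj.ne]
  | add e₁ e₂ ih₁ ih₂ =>
    intro d p m s hm hP
    obtain ⟨hA, hP⟩ := hP.append
    obtain ⟨hB, hC⟩ := hP.append
    obtain ⟨m₁, h1, hm₁, hv₁, hlow₁⟩ := ih₁ d p m s hm hA
    obtain ⟨m₂, h2, hm₂, hv₂, hlow₂⟩ := ih₂ (d + 1) _ m₁ s hm₁ hB
    have h3 := within_effect (input := inp) m₂ (by simp [Instr.IsPlain]) hC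
    refine ⟨_, (h1.trans (h2.trans h3)).weaken ?_ ?_, hm₂.update_aux d _, ?_, ?_⟩
    · simp [Expr.cost, add_assoc]
    · simp [Expr.code, add_assoc]
    · simp [effect, Instr.exec, Expr.eval, hlow₂, hv₁, hv₂]
    · intro j hj
      simp [effect, Instr.exec, hj.ne, hlow₂ j (by omega), hlow₁ j hj]
  | sub e₁ e₂ ih₁ ih₂ =>
    intro d p m s hm hP
    obtain ⟨hA, hP⟩ := hP.append
    obtain ⟨hB, hC⟩ := hP.append
    obtain ⟨m₁, h1, hm₁, hv₁, hlow₁⟩ := ih₁ d p m s hm hA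
    obtain ⟨m₂, h2, hm₂, hv₂, hlow₂⟩ := ih₂ (d + 1) _ m₁ s hm₁ hB
    have h3 := within_effect (input := inp) m₂ (by simp [Instr.IsPlain]) hC
    refine ⟨_, (h1.trans (h2.trans h3)).weaken ?_ ?_, hm₂.update_aux d _, ?_, ?_⟩
    · simp [Expr.cost, add_assoc]
    · simp [Expr.code, add_assoc]
    · simp [effect, Instr.exec, Expr.eval, hlow₂, hv₁, hv₂]
    · intro j hj
      simp [effect, Instr.exec, hj.ne, hlow₂ j (by omega), hlow₁ j hj]
  | input e ih =>
    intro d p m s hm hP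
    obtain ⟨hA, hB⟩ := hP.append
    obtain ⟨m₁, h1, hm₁, hv₁, hlow₁⟩ := ih d p m s hm hA
    have h2 := within_effect (input := inp) m₁ (by simp [Instr.IsPlain]) hB
    refine ⟨_, (h1.trans h2).weaken ?_ ?_, hm₁.update_aux d _, ?_, ?_⟩
    · simp [Expr.cost]
    · simp [Expr.code, add_assoc]
    · simp [effect, Instr.exec, Expr.eval, hv₁]
    · intro j hj
      simp [effect, Instr.exec, hj.ne, hlow₁ j hj]
  | get a e ih =>
    intro d p m s hm hP
    obtain ⟨hA, hP⟩ := hP.append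
    obtain ⟨hB, hC⟩ := hP.append
    obtain ⟨m₁, h1, hm₁, hv₁, hlow₁⟩ := ih d p m s hm hA
    have h2 := within_effect (input := inp) m₁ (isPlain_addrCode a d) hB
    obtain ⟨hm₂, hv₂, hlow₂⟩ := effect_addrCode (inp := inp) a d hm₁
    have h3 := within_effect (input := inp) (effect inp (addrCode a d) m₁)
      (by simp [Instr.IsPlain]) hC
    refine ⟨_, (h1.trans (h2.trans h3)).weaken ?_ ?_, hm₂.update_aux d _, ?_, ?_⟩
    · simp [Expr.cost, addrCode]
    · simp [Expr.code, add_assoc]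
    · change Function.update (effect inp (addrCode a d) m₁) _ _ _ = _
      simp [Expr.eval, hv₁, hv₂, hm₂.arr]
    · intro j hj
      change Function.update (effect inp (addrCode a d) m₁) _ _ _ = _
      simp [hj.ne, hlow₂ j hj, hlow₁ j hj]
  | ite e e₁ e₂ ih ih₁ ih₂ =>
    intro d p m s hm hP
    obtain ⟨hA, hP⟩ := hP.append
    obtain ⟨hB, hP⟩ := hP.append
    obtain ⟨hC, hP⟩ := hP.append
    obtain ⟨hD, hP⟩ := hP.append
    obtain ⟨hE, hF⟩ := hP.append
    obtain ⟨m₁, h1, hm₁, hv₁, hlow₁⟩ := ih d p m s hm hA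
    have h2 := within_jumpZero (input := inp) m₁ hB
    by_cases hz : e.eval inp s = 0
    · rw [if_pos (hv₁.trans hz)] at h2
      obtain ⟨m₂, h3, hm₂, hv₂, hlow₂⟩ := ih₂ d _ m₁ s hm₁ hF
      simp only [List.length_singleton] at h3
      rw [show ∀ a b : ℕ, a + 1 + b + 1 + 1 = a + 1 + b + 2 by intros; rfl] at h3
      refine ⟨m₂, (h1.trans (h2.trans h3)).weaken ?_ ?_, hm₂, ?_, ?_⟩
      · simp only [Expr.cost]
        omega
      · simp only [Expr.code, List.length_append, List.length_singleton]
        omega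
      · simp [Expr.eval, hz, hv₂]
      · intro j hj
        rw [hlow₂ j hj, hlow₁ j hj]
    · rw [if_neg (by rwa [hv₁])] at h2
      obtain ⟨m₂, h3, hm₂, hv₂, hlow₂⟩ := ih₁ d _ m₁ s hm₁ hC
      have h4 := within_effect (input := inp) m₂ (by simp [Instr.IsPlain]) hD
      have h5 := within_jumpZero (input := inp)
        (effect inp [.const (auxAddr (d + 1)) 0] m₂) hE
      rw [if_pos (by simp [effect, Instr.exec])] at h5
      refine ⟨_, (h1.trans (h2.trans (h3.trans (h4.trans h5)))).weaken ?_ ?_,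
        hm₂.update_aux (d + 1) _, ?_, ?_⟩
      · simp only [Expr.cost, List.length_singleton]
        omega
      · simp only [Expr.code, List.length_append, List.length_singleton]
        omega
      · simp [effect, Instr.exec, Expr.eval, hz, hv₂]
      · intro j hj
        simp [effect, Instr.exec, hlow₂ j hj, hlow₁ j hj, (show j ≠ d + 1 by omega)]
  | sum x e₁ e₂ ih₁ ih₂ =>
    intro d p m s hm hP
    obtain ⟨hA, hP⟩ := hP.append
    obtain ⟨hB, hP⟩ := hP.append
    rw [← List.append_assoc, ← List.append_assoc, ← List.append_assoc] at hP
    obtain ⟨hC, hD⟩ := hP.append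
    obtain ⟨m₁, h1, hm₁, hv₁, hlow₁⟩ := ih₁ d p m s hm hA
    have h2 := within_effect (input := inp) m₁ (by simp [Instr.IsPlain]) hB
    set m₂ := effect inp [.const (auxAddr (d + 1)) 0, .const (auxAddr (d + 2)) 0,
        .add (auxAddr (d + 2)) (auxAddr (d + 2)) (regAddr x), .const (regAddr x) 0] m₁ with hm₂
    simp only [effect, List.foldl, Instr.exec] at hm₂
    have e1 : m₂ (auxAddr d) = e₁.eval inp s := by simp [hm₂, hv₁]
    have e2 : m₂ (auxAddr (d + 1)) = 0 := by simp [hm₂]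
    have e3 : m₂ (auxAddr (d + 2)) = s.reg x := by simp [hm₂, hm₁.reg]
    have e4 : ∀ j < d, m₂ (auxAddr j) = m (auxAddr j) := by
      intro j hj
      simp [hm₂, hlow₁ j hj, (show j ≠ d + 1 by omega), (show j ≠ d + 2 by omega)]
    have e5 : Represents m₂ (s.setReg x 0) := by
      rw [hm₂]
      exact (((hm₁.update_aux _ _).update_aux _ _).update_aux _ _).update_reg x 0
    obtain ⟨t, m₃, h3, ht, hm₃, f1, f2, f3⟩ := Expr.sum_loop ih₂ x d
      (p + (e₁.code d p).length + 4) s _ (by simp only [List.append_assoc]) hC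
      (e₁.eval inp s) 0 m₂ e5 e1 (by simpa using e2)
    have h4 := within_effect (input := inp) m₃ (by simp [Instr.IsPlain]) hD
    have h5 := h1.trans (h2.trans ((h3.weaken le_rfl (by simp; omega)).trans h4))
    rw [zero_add] at ht hm₃ f1
    refine ⟨_, h5.weaken ?_ ?_, ?_, ?_, ?_⟩
    · simp only [Expr.cost, List.length_cons, List.length_nil, Finset.range_zero,
        Finset.sum_empty] at ht ⊢
      omega
    · simp only [Expr.code, List.length_append, List.length_cons, List.length_nil]
      omega
    · have := ((hm₃.update_aux (d + 3) 0).update_aux d (m₃ (auxAddr (d + 1)))).update_reg x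
        (s.reg x)
      rw [Store.setReg_setReg, Store.setReg_self] at this
      simpa [effect, Instr.exec, f2, e3] using this
    · simp [effect, Instr.exec, f1, Expr.eval]
    · intro j hj
      simp [effect, Instr.exec, f3 j hj, e4 j hj, hj.ne, (show j ≠ d + 3 by omega)]

/-- What the code of a command achieves. -/
def Cmd.CodeSpec (P : Program) (inp : List ℕ) (c : Cmd) : Prop :=
  ∀ (d p : ℕ) (m : ℕ → ℕ) (s : Store), Represents m s → CodeAt P p (c.code d p) →
    ∃ m', Within P inp (c.cost inp s) ⟨p, m⟩ ⟨p + (c.code d p).length, m'⟩ ∧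
      Represents m' (c.run inp s) ∧ ∀ j < d, m' (auxAddr j) = m (auxAddr j)

theorem Cmd.loop_spec {c : Cmd} (hc : c.CodeSpec P inp) (x d q : ℕ) (s : Store)
    (hP : CodeAt P q ([.jumpZero (auxAddr d) (q + 3 + (c.code (d + 2) (q + 3)).length + 5)] ++
      ([.const (auxAddr (d + 2)) 0, .add (regAddr x) (auxAddr (d + 1)) (auxAddr (d + 2))] ++
      (c.code (d + 2) (q + 3) ++
      ([.const (auxAddr (d + 2)) 1, .add (auxAddr (d + 1)) (auxAddr (d + 1)) (auxAddr (d + 2)),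
        .sub (auxAddr d) (auxAddr d) (auxAddr (d + 2)), .const (auxAddr (d + 2)) 0] ++
      [.jumpZero (auxAddr (d + 2)) q]))))) (k : ℕ) : ∀ (i : ℕ) (m : ℕ → ℕ),
      Represents m (iter (fun i s => c.run inp (s.setReg x i)) i s) →
      m (auxAddr d) = k → m (auxAddr (d + 1)) = i →
      ∃ t m', Within P inp t ⟨q, m⟩ ⟨q + 3 + (c.code (d + 2) (q + 3)).length + 5, m'⟩ ∧
        t + ∑ j ∈ Finset.range i,
          (c.cost inp ((iter (fun i s => c.run inp (s.setReg x i)) j s).setReg x j) + 8) ≤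
          1 + ∑ j ∈ Finset.range (i + k),
          (c.cost inp ((iter (fun i s => c.run inp (s.setReg x i)) j s).setReg x j) + 8) ∧
        Represents m' (iter (fun i s => c.run inp (s.setReg x i)) (i + k) s) ∧
        ∀ j < d, m' (auxAddr j) = m (auxAddr j) := by
  obtain ⟨hA, hP'⟩ := hP.append
  obtain ⟨hB, hP'⟩ := hP'.append
  obtain ⟨hC, hP'⟩ := hP'.append
  obtain ⟨hD, hE⟩ := hP'.append
  induction k with
  | zero =>
    intro i m hm hk hacc
    refine ⟨1, m, ?_, ?_, by simpa using hm, fun _ _ => rfl⟩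
    · simpa [hk] using within_jumpZero (input := inp) m hA
    · simp
  | succ k ih =>
    intro i m hm hk hi
    have h1 := within_jumpZero (input := inp) m hA
    rw [if_neg (by omega)] at h1
    have h2 := within_effect (input := inp) m (by simp [Instr.IsPlain]) hB
    set m₁ := effect inp [.const (auxAddr (d + 2)) 0,
      .add (regAddr x) (auxAddr (d + 1)) (auxAddr (d + 2))] m with hm₁
    simp only [effect, List.foldl, Instr.exec] at hm₁
    have hrep₁ : Represents m₁
        ((iter (fun i s => c.run inp (s.setReg x i)) i s).setReg x i) := by
      have := (hm.update_aux (d + 2) 0).update_reg x i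
      rw [hm₁]
      simpa [hi] using this
    have hlow₁ : ∀ j < d + 2, m₁ (auxAddr j) = m (auxAddr j) := by
      intro j hj
      simp [hm₁, hj.ne]
    obtain ⟨m₂, h3, hrep₂, hlow₂⟩ := hc (d + 2) (q + 3) m₁ _ hrep₁ hC
    have h4 := within_effect (input := inp) m₂ (by simp [Instr.IsPlain]) hD
    set m₃ := effect inp [.const (auxAddr (d + 2)) 1,
      .add (auxAddr (d + 1)) (auxAddr (d + 1)) (auxAddr (d + 2)),
      .sub (auxAddr d) (auxAddr d) (auxAddr (d + 2)), .const (auxAddr (d + 2)) 0] m₂ with hm₃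
    simp only [effect, List.foldl, Instr.exec] at hm₃
    have hrep₃ : Represents m₃ (iter (fun i s => c.run inp (s.setReg x i)) (i + 1) s) := by
      rw [hm₃]
      exact (((hrep₂.update_aux _ _).update_aux _ _).update_aux _ _).update_aux _ _
    have e0 : m₃ (auxAddr (d + 2)) = 0 := by simp [hm₃]
    have e1 : m₃ (auxAddr d) = k := by
      simp [hm₃, hlow₂ d (by omega), hlow₁ d (by omega), hk]
    have e2 : m₃ (auxAddr (d + 1)) = i + 1 := by
      simp [hm₃, hlow₂ (d + 1) (by omega), hlow₁ (d + 1) (by omega), hi]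
    have e3 : ∀ j < d, m₃ (auxAddr j) = m (auxAddr j) := by
      intro j hj
      simp [hm₃, hlow₂ j (by omega), hlow₁ j (by omega), hj.ne, (show j ≠ d + 1 by omega),
        (show j ≠ d + 2 by omega)]
    have h5 := within_jumpZero (input := inp) m₃ hE
    rw [if_pos e0] at h5
    obtain ⟨t, m₄, h6, ht, hrep₄, hlow₄⟩ := ih (i + 1) m₃ hrep₃ e1 e2
    refine ⟨_, m₄, h1.trans (h2.trans (h3.trans (h4.trans (h5.trans h6)))), ?_, ?_,
      fun j hj => (hlow₄ j hj).trans (e3 j hj)⟩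
    · rw [Finset.sum_range_succ] at ht
      rw [show i + (k + 1) = i + 1 + k by omega]
      simp only [List.length_cons, List.length_nil]
      omega
    · rwa [show i + (k + 1) = i + 1 + k by omega]

theorem Cmd.code_spec (c : Cmd) : c.CodeSpec P inp := by
  induction c with
  | assign x e =>
    intro d p m s hm hP
    obtain ⟨hA, hB⟩ := hP.append
    obtain ⟨m₁, h1, hm₁, hv₁, hlow₁⟩ := e.code_spec d p m s hm hA
    have h2 := within_effect (input := inp) m₁ (by simp [Instr.IsPlain]) hB
    refine ⟨_, (h1.trans h2).weaken ?_ ?_, ?_, ?_⟩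
    · simp [Cmd.cost]
    · simp [Cmd.code, add_assoc]
    · have := (hm₁.update_aux (d + 1) 0).update_reg x (e.eval inp s)
      simpa [effect, Instr.exec, Cmd.run, hv₁] using this
    · intro j hj
      simp [effect, Instr.exec, hlow₁ j hj, (show j ≠ d + 1 by omega)]
  | store a e₁ e₂ =>
    intro d p m s hm hP
    obtain ⟨hA, hP⟩ := hP.append
    obtain ⟨hB, hP⟩ := hP.append
    obtain ⟨hC, hD⟩ := hP.append
    obtain ⟨m₁, h1, hm₁, hv₁, hlow₁⟩ := e₁.code_spec d p m s hm hA
    have h2 := within_effect (input := inp) m₁ (isPlain_addrCode a d) hB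
    obtain ⟨hm₂, hv₂, hlow₂⟩ := effect_addrCode (inp := inp) a d hm₁
    obtain ⟨m₃, h3, hm₃, hv₃, hlow₃⟩ := e₂.code_spec (d + 1) _ _ s hm₂ hC
    have h4 := within_effect (input := inp) m₃ (by simp [Instr.IsPlain]) hD
    have hv : m₃ (auxAddr d) = arrAddr a (e₁.eval inp s) := by rw [hlow₃ d (by omega), hv₂, hv₁]
    refine ⟨_, (h1.trans (h2.trans (h3.trans h4))).weaken ?_ ?_, ?_, ?_⟩
    · simp [Cmd.cost, addrCode]
      omega
    · simp [Cmd.code, addrCode]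
      omega
    · change Represents (Function.update m₃ (m₃ (auxAddr d)) (m₃ (auxAddr (d + 1)))) _
      rw [hv, hv₃]
      exact hm₃.update_arr a _ _
    · intro j hj
      change Function.update m₃ (m₃ (auxAddr d)) (m₃ (auxAddr (d + 1))) _ = _
      rw [hv, Function.update_of_ne auxAddr_ne_arrAddr, hlow₃ j (by omega), hlow₂ j hj, hlow₁ j hj]
  | seq c₁ c₂ ih₁ ih₂ =>
    intro d p m s hm hP
    obtain ⟨hA, hB⟩ := hP.append
    obtain ⟨m₁, h1, hm₁, hlow₁⟩ := ih₁ d p m s hm hA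
    obtain ⟨m₂, h2, hm₂, hlow₂⟩ := ih₂ d _ m₁ _ hm₁ hB
    refine ⟨m₂, (h1.trans h2).weaken le_rfl ?_, hm₂, fun j hj => (hlow₂ j hj).trans (hlow₁ j hj)⟩
    simp [Cmd.code, add_assoc]
  | loop x e c ih =>
    intro d p m s hm hP
    obtain ⟨hA, hP⟩ := hP.append
    obtain ⟨hB, hC⟩ := hP.append
    obtain ⟨m₁, h1, hm₁, hv₁, hlow₁⟩ := e.code_spec (inp := inp) d p m s hm hA
    have h2 := within_effect (input := inp) m₁ (by simp [Instr.IsPlain]) hB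
    obtain ⟨t, m₂, h3, ht, hm₂, hlow₂⟩ := Cmd.loop_spec ih x d
      (p + (e.code d p).length + 1) s hC (e.eval inp s) 0
      (effect inp [.const (auxAddr (d + 1)) 0] m₁) (hm₁.update_aux _ _)
      (by simp [effect, Instr.exec, hv₁]) (by simp [effect, Instr.exec])
    rw [zero_add] at ht hm₂
    refine ⟨m₂, (h1.trans (h2.trans h3)).weaken ?_ ?_, hm₂, ?_⟩
    · simp only [Cmd.cost, List.length_singleton, Finset.range_zero, Finset.sum_empty] at ht ⊢
      omega
    · simp only [Cmd.code, List.length_append, List.length_cons, List.length_nil]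
      omega
    · intro j hj
      rw [hlow₂ j hj]
      simp [effect, Instr.exec, hlow₁ j hj, (show j ≠ d + 1 by omega)]

end Correctness

/-- The store at the start of a computation. -/
def initialStore (inp : List ℕ) : Store :=
  ⟨Function.update (fun _ => 0) 0 inp.length, fun _ _ => 0⟩

/-- The result of a command on an input, as computed by the machine. -/
theorem Cmd.outputsWithin (c : Cmd) (inp : List ℕ) {t : ℕ}
    (ht : c.cost inp (initialStore inp) ≤ t) :
    OutputsWithin (c.code 0 0) inp t
      ((c.run inp (initialStore inp)).reg 0) := by
  have hrep : Represents (initial inp).mem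
      (initialStore inp) := by
    constructor
    · intro x
      simp only [initial, initialStore, regAddr, Function.update_apply]
      simp
    · intro a i
      simp [initial, initialStore, arrAddr]
  obtain ⟨m, ⟨t', ht', h⟩, hm, -⟩ := c.code_spec (P := c.code 0 0) (inp := inp) 0 0 _ _ hrep
    ⟨[], by simp⟩
  -- A halted configuration is a fixed point, so the actual running time may be replaced by any
  -- larger `t`.
  have hfix : ∀ n, (step (c.code 0 0) inp)^[n] ⟨0 + (c.code 0 0).length, m⟩ =
      ⟨0 + (c.code 0 0).length, m⟩ := by
    intro n
    apply Function.iterate_fixed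
    simp [step]
  have hfin : (step (c.code 0 0) inp)^[t] (initial inp) = ⟨0 + (c.code 0 0).length, m⟩ := by
    rw [show t = (t - t') + t' by omega, Function.iterate_add_apply]
    change (step (c.code 0 0) inp)^[t - t'] ((step (c.code 0 0) inp)^[t'] ⟨0, (initial inp).mem⟩) = _
    rw [h, hfix]
  rw [OutputsWithin, hfin]
  exact ⟨by simp, hm.reg 0⟩


/-! ### Frames and running times -/

/-- The registers that a command may change. -/
def Cmd.regs : Cmd → List ℕ
  | .assign x _ => [x]
  | .store _ _ _ => []
  | .seq c₁ c₂ => c₁.regs ++ c₂.regs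
  | .loop x _ c => x :: c.regs

/-- The arrays that a command may change. -/
def Cmd.arrs : Cmd → List (Fin 3)
  | .assign _ _ => []
  | .store a _ _ => [a]
  | .seq c₁ c₂ => c₁.arrs ++ c₂.arrs
  | .loop _ _ c => c.arrs

theorem iter_invariant {α β : Type*} {f : ℕ → α → α} {g : α → β} (h : ∀ i s, g (f i s) = g s)
    (k : ℕ) (s : α) : g (iter f k s) = g s := by
  induction k with
  | zero => rfl
  | succ k ih => rw [iter, h, ih]

/-- The frame rule. The list `regs` is computed from the syntax, so `decide` settles its hypothesis
for concrete commands. -/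
theorem Cmd.run_reg (inp : List ℕ) (c : Cmd) {x : ℕ} (hx : x ∉ c.regs) (s : Store) :
    (c.run inp s).reg x = s.reg x := by
  induction c generalizing s with
  | assign y e =>
    have : x ≠ y := by simpa [Cmd.regs] using hx
    simp [Cmd.run, Store.setReg_reg, this]
  | store a e₁ e₂ => rfl
  | seq c₁ c₂ ih₁ ih₂ =>
    simp only [Cmd.regs, List.mem_append, not_or] at hx
    rw [Cmd.run, ih₂ hx.2, ih₁ hx.1]
  | loop y e c ih =>
    simp only [Cmd.regs, List.mem_cons, not_or] at hx
    rw [Cmd.run]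
    refine iter_invariant (g := fun s : Store => s.reg x) (fun i s => ?_) _ s
    rw [ih hx.2, Store.setReg_reg, if_neg hx.1]

theorem Cmd.run_arr (inp : List ℕ) (c : Cmd) {a : Fin 3} (ha : a ∉ c.arrs) (s : Store) :
    (c.run inp s).arr a = s.arr a := by
  induction c generalizing s with
  | assign y e => rfl
  | store b e₁ e₂ =>
    have : a ≠ b := by simpa [Cmd.arrs] using ha
    simp [Cmd.run, Store.setArr, this]
  | seq c₁ c₂ ih₁ ih₂ =>
    simp only [Cmd.arrs, List.mem_append, not_or] at ha
    rw [Cmd.run, ih₂ ha.2, ih₁ ha.1]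
  | loop y e c ih =>
    rw [Cmd.run]
    refine iter_invariant (g := fun s : Store => s.arr a) (fun i s => ?_) _ s
    exact ih ha _

/-- The expression is a register from the list `W`. -/
def Expr.isRegIn (W : List ℕ) : Expr → Bool
  | .reg y => decide (y ∈ W)
  | _ => false

/-- All sums in the expression are bounded by registers in `W`, which are not changed. -/
def Expr.boundedBy (W : List ℕ) : Expr → Bool
  | .const _ => true
  | .reg _ => true
  | .add e₁ e₂ => e₁.boundedBy W && e₂.boundedBy W
  | .sub e₁ e₂ => e₁.boundedBy W && e₂.boundedBy W
  | .input e => e.boundedBy W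
  | .get _ e => e.boundedBy W
  | .ite e e₁ e₂ => e.boundedBy W && e₁.boundedBy W && e₂.boundedBy W
  | .sum x e₁ e₂ => e₁.isRegIn W && decide (x ∉ W) && e₂.boundedBy W

/-- All loops in the command are bounded by registers in `W`, which are not changed. -/
def Cmd.boundedBy (W : List ℕ) : Cmd → Bool
  | .assign x e => decide (x ∉ W) && e.boundedBy W
  | .store _ e₁ e₂ => e₁.boundedBy W && e₂.boundedBy W
  | .seq c₁ c₂ => c₁.boundedBy W && c₂.boundedBy W
  | .loop x e c => e.isRegIn W && decide (x ∉ W) && c.boundedBy W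

theorem Expr.isRegIn_iff {W : List ℕ} {e : Expr} : e.isRegIn W = true ↔ ∃ y ∈ W, e = .reg y := by
  cases e <;> simp [Expr.isRegIn]

theorem Cmd.notMem_regs_of_boundedBy {W : List ℕ} {c : Cmd} (h : c.boundedBy W = true) {x : ℕ}
    (hx : x ∈ W) : x ∉ c.regs := by
  induction c with
  | assign y e =>
    simp only [Cmd.boundedBy, Bool.and_eq_true, decide_eq_true_eq] at h
    simp only [Cmd.regs, List.mem_singleton]
    rintro rfl
    exact h.1 hx
  | store => simp [Cmd.regs]
  | seq c₁ c₂ ih₁ ih₂ =>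
    simp only [Cmd.boundedBy, Bool.and_eq_true] at h
    simp [Cmd.regs, ih₁ h.1, ih₂ h.2]
  | loop y e c ih =>
    simp only [Cmd.boundedBy, Bool.and_eq_true, decide_eq_true_eq] at h
    simp only [Cmd.regs, List.mem_cons, not_or]
    refine ⟨?_, ih h.2⟩
    rintro rfl
    exact h.1.2 hx

/-- A cost that is polynomial in the contents of the registers in `W`. -/
def PolyCost (W : List ℕ) (cost : List ℕ → Store → ℕ) : Prop :=
  ∃ A d, ∀ inp M s, (∀ y ∈ W, s.reg y ≤ M) → cost inp s ≤ A * (M + 1) ^ d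

section PolyCost

variable {W : List ℕ}

theorem PolyCost.const (c : ℕ) : PolyCost W fun _ _ => c :=
  ⟨c, 0, fun _ _ _ _ => by simp⟩

theorem PolyCost.add {f g : List ℕ → Store → ℕ} (hf : PolyCost W f) (hg : PolyCost W g) :
    PolyCost W fun inp s => f inp s + g inp s := by
  obtain ⟨A, d, hf⟩ := hf
  obtain ⟨B, e, hg⟩ := hg
  refine ⟨A + B, d + e, fun inp M s hs => ?_⟩
  have h1 : (M + 1) ^ d ≤ (M + 1) ^ (d + e) := Nat.pow_le_pow_right (by omega) (by omega)
  have h2 : (M + 1) ^ e ≤ (M + 1) ^ (d + e) := Nat.pow_le_pow_right (by omega) (by omega)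
  rw [add_mul]
  exact add_le_add ((hf inp M s hs).trans (Nat.mul_le_mul_left _ h1))
    ((hg inp M s hs).trans (Nat.mul_le_mul_left _ h2))

/-- The stores `σ inp s i` agree with `s` on `W`, so one bound `M` serves all rounds; there are at
most `M` rounds, which raises the degree by one. -/
theorem PolyCost.sum {f : List ℕ → Store → ℕ} (hf : PolyCost W f) {y : ℕ} (hy : y ∈ W)
    {σ : List ℕ → Store → ℕ → Store}
    (hσ : ∀ inp s i, ∀ z ∈ W, (σ inp s i).reg z = s.reg z) :
    PolyCost W fun inp s => ∑ i ∈ Finset.range (s.reg y), f inp (σ inp s i) := by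
  obtain ⟨A, d, hf⟩ := hf
  refine ⟨A, d + 1, fun inp M s hs => ?_⟩
  calc ∑ i ∈ Finset.range (s.reg y), f inp (σ inp s i)
      ≤ ∑ i ∈ Finset.range (s.reg y), A * (M + 1) ^ d :=
        Finset.sum_le_sum fun i _ => hf inp M _ fun z hz => (hσ inp s i z hz).trans_le (hs z hz)
    _ = s.reg y * (A * (M + 1) ^ d) := by simp
    _ ≤ (M + 1) * (A * (M + 1) ^ d) := Nat.mul_le_mul_right _ ((hs y hy).trans (by omega))
    _ = A * (M + 1) ^ (d + 1) := by ring

theorem Expr.polyCost {e : Expr} (h : e.boundedBy W = true) : PolyCost W fun inp => e.cost inp := by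
  induction e with
  | const c => exact .const 1
  | reg x => exact .const 2
  | add e₁ e₂ ih₁ ih₂ =>
    simp only [Expr.boundedBy, Bool.and_eq_true] at h
    exact ((ih₁ h.1).add (ih₂ h.2)).add (.const 1)
  | sub e₁ e₂ ih₁ ih₂ =>
    simp only [Expr.boundedBy, Bool.and_eq_true] at h
    exact ((ih₁ h.1).add (ih₂ h.2)).add (.const 1)
  | input e ih => exact (ih h).add (.const 1)
  | get a e ih => exact (ih h).add (.const 6)
  | ite e e₁ e₂ ih ih₁ ih₂ =>
    simp only [Expr.boundedBy, Bool.and_eq_true] at h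
    exact ((ih h.1.1).add ((ih₁ h.1.2).add (ih₂ h.2))).add (.const 3)
  | sum x e₁ e₂ _ ih₂ =>
    simp only [Expr.boundedBy, Bool.and_eq_true, decide_eq_true_eq, Expr.isRegIn_iff] at h
    obtain ⟨⟨⟨y, hy, rfl⟩, hx⟩, h2⟩ := h
    refine ((PolyCost.const 2).add (((ih₂ h2).add (.const 7)).sum hy
      (σ := fun _ s i => s.setReg x i) ?_)).add (.const 8)
    intro inp s i z hz
    rw [Store.setReg_reg, if_neg]
    rintro rfl
    exact hx hz

theorem Cmd.polyCost {c : Cmd} (h : c.boundedBy W = true) : PolyCost W fun inp => c.cost inp := by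
  induction c with
  | assign x e =>
    simp only [Cmd.boundedBy, Bool.and_eq_true] at h
    exact (Expr.polyCost h.2).add (.const 2)
  | store a e₁ e₂ =>
    simp only [Cmd.boundedBy, Bool.and_eq_true] at h
    exact ((Expr.polyCost h.1).add (Expr.polyCost h.2)).add (.const 6)
  | seq c₁ c₂ ih₁ ih₂ =>
    simp only [Cmd.boundedBy, Bool.and_eq_true] at h
    obtain ⟨A, d, h2⟩ := ih₂ h.2
    refine (ih₁ h.1).add ⟨A, d, fun inp M s hs => h2 inp M _ fun z hz => ?_⟩
    rw [Cmd.run_reg inp c₁ (Cmd.notMem_regs_of_boundedBy h.1 hz)]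
    exact hs z hz
  | loop x e c ih =>
    simp only [Cmd.boundedBy, Bool.and_eq_true, decide_eq_true_eq, Expr.isRegIn_iff] at h
    obtain ⟨⟨⟨y, hy, rfl⟩, hx⟩, h2⟩ := h
    have hxz : ∀ z ∈ W, ∀ (s : Store) (i : ℕ), (s.setReg x i).reg z = s.reg z := by
      intro z hz s i
      rw [Store.setReg_reg, if_neg]
      rintro rfl
      exact hx hz
    refine ((PolyCost.const 2).add (((ih h2).add (.const 8)).sum hy (σ := fun inp s i =>
      (iter (fun i s => c.run inp (s.setReg x i)) i s).setReg x i) ?_)).add (.const 2)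
    intro inp s i z hz
    rw [hxz z hz]
    refine iter_invariant (g := fun s : Store => s.reg z) (fun i s => ?_) _ s
    rw [Cmd.run_reg inp c (Cmd.notMem_regs_of_boundedBy h2 hz), hxz z hz]

end PolyCost


/-! ### Truth values -/

/-- The number `v` is the truth value of `p`. -/
def Tells (v : ℕ) (p : Prop) : Prop := (v = 1 ∧ p) ∨ (v = 0 ∧ ¬ p)

section Tells

variable {a b : ℕ} {p q : Prop}

theorem Tells.ne_zero (h : Tells a p) : a ≠ 0 ↔ p := by
  rcases h with ⟨rfl, h⟩ | ⟨rfl, h⟩ <;> simp [h]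

theorem Tells.congr (h : Tells a p) (hpq : p ↔ q) : Tells a q := by
  rwa [← propext hpq]

/-- The first argument is only required to be nonzero exactly when `p` holds, because existential
quantifiers are evaluated as sums that count witnesses. -/
theorem Tells.and (hp : a ≠ 0 ↔ p) (hq : Tells b q) : Tells (if a = 0 then 0 else b) (p ∧ q) := by
  by_cases h : a = 0 <;> rcases hq with ⟨rfl, hq⟩ | ⟨rfl, hq⟩ <;> simp_all [Tells]

theorem Tells.not_and (hp : a ≠ 0 ↔ p) (hq : Tells b q) :
    Tells (if a = 0 then b else 0) (¬ p ∧ q) := by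
  by_cases h : a = 0 <;> rcases hq with ⟨rfl, hq⟩ | ⟨rfl, hq⟩ <;> simp_all [Tells]

theorem Tells.or (hp : a ≠ 0 ↔ p) (hq : Tells b q) : Tells (if a = 0 then b else 1) (p ∨ q) := by
  by_cases h : a = 0 <;> rcases hq with ⟨rfl, hq⟩ | ⟨rfl, hq⟩ <;> simp_all [Tells]

theorem Tells.not (hp : a ≠ 0 ↔ p) : Tells (1 - a) (¬ p) := by
  rw [← hp]
  unfold Tells
  omega

theorem Tells.of_ne_zero (hp : a ≠ 0 ↔ p) : Tells (if a = 0 then 0 else 1) p := by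
  by_cases h : a = 0 <;> simp_all [Tells]

theorem tells_le (a b : ℕ) : Tells (1 - (a - b)) (a ≤ b) := by
  unfold Tells
  omega

theorem tells_eq (a b : ℕ) : Tells (1 - ((a - b) + (b - a))) (a = b) := by
  unfold Tells
  omega

theorem sum_range_ne_zero_iff {n : ℕ} {f : ℕ → ℕ} {p : Fin n → Prop}
    (h : ∀ i : Fin n, f i ≠ 0 ↔ p i) : ∑ i ∈ Finset.range n, f i ≠ 0 ↔ ∃ i, p i := by
  rw [Finset.sum_range, Ne, Finset.sum_eq_zero_iff]
  push Not
  simp [h]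

theorem sum_range_eq_card {n : ℕ} {f : ℕ → ℕ} {U : Finset (Fin n)}
    (h : ∀ i : Fin n, Tells (f i) (i ∈ U)) : ∑ i ∈ Finset.range n, f i = U.card := by
  rw [Finset.sum_range, Finset.card_eq_sum_ones, ← Finset.sum_filter_add_sum_filter_not _ (· ∈ U)]
  rw [Finset.sum_congr rfl fun i hi => ?_, Finset.sum_eq_zero (s := Finset.univ.filter (· ∉ U))]
  · simp only [Finset.filter_univ_mem]
    rfl
  · intro i hi
    rcases h i with h | h
    · exact absurd h.2 (Finset.mem_filter.1 hi).2
    · exact h.1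
  · rcases h i with h | h
    · exact h.1
    · exact absurd (Finset.mem_filter.1 hi).2 h.2

/-- Multiplication on a machine that only adds and subtracts: `1 - (j + 1 - a)` is the truth value
of `j < a`, and the range only has to be long enough. -/
theorem sum_range_ite_lt {n a : ℕ} (ha : a ≤ n) (c : ℕ) :
    ∑ j ∈ Finset.range n, (if 1 - (j + 1 - a) = 0 then 0 else c) = a * c := by
  calc ∑ j ∈ Finset.range n, (if 1 - (j + 1 - a) = 0 then 0 else c)
      = ∑ j ∈ Finset.range n, if j ∈ Finset.range a then c else 0 := by
        refine Finset.sum_congr rfl fun j _ => ?_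
        simp only [Finset.mem_range]
        split_ifs <;> first | rfl | omega
    _ = _ := by
        rw [← Finset.sum_filter, Finset.filter_mem_eq_inter,
          Finset.inter_eq_right.2 (Finset.range_mono ha)]
        simp

end Tells

theorem iter_induction {α : Type*} {f : ℕ → α → α} {k : ℕ} {s : α} (p : ℕ → α → Prop) (h0 : p 0 s)
    (hstep : ∀ i < k, ∀ s, p i s → p (i + 1) (f i s)) : p k (iter f k s) := by
  induction k with
  | zero => exact h0
  | succ k ih => exact hstep k (by omega) _ (ih fun i hi => hstep i (by omega))

/-! ### The input -/

theorem getElem?_flatMap_of_length {α β : Type*} {g : α → List β} {m : ℕ}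
    (hg : ∀ u, (g u).length = m) (l : List α) (i j : ℕ) (hj : j < m) :
    (l.flatMap g)[i * m + j]? = l[i]?.bind fun u => (g u)[j]? := by
  induction l generalizing i with
  | nil => simp
  | cons u l ih =>
    rw [List.flatMap_cons]
    cases i with
    | zero => simp [List.getElem?_append_left (by rw [hg]; exact hj : j < (g u).length)]
    | succ i =>
      rw [List.getElem?_append_right (by rw [hg]; nlinarith), hg,
        show (i + 1) * m + j - m = i * m + j by
          rw [add_mul, one_mul]; omega, ih]
      simp

theorem Inst.length_encode (x : Inst) : x.encode.length = 3 + x.n * x.n := by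
  simp [Inst.encode, List.length_flatMap]
  omega

theorem Inst.tells_encode (x : Inst) (v w : Fin x.n) :
    Tells (x.encode.getD (3 + v * x.n + w) 0) (x.D.Adj v w) := by
  classical
  have h := getElem?_flatMap_of_length
    (g := fun u => (List.finRange x.n).map fun v => if x.D.Adj u v then 1 else 0) (m := x.n)
    (by simp) (List.finRange x.n) v w w.2
  have h2 : x.encode[3 + v * x.n + w]? = some (if x.D.Adj v w then 1 else 0) := by
    rw [Inst.encode, List.getElem?_append_right (by simp; omega)]
    simp only [List.length_cons, List.length_nil]
    rw [show 3 + v * x.n + w - (0 + 1 + 1 + 1) = v * x.n + w by omega]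
    convert h using 1
    simp
  rw [List.getD_eq_getElem?_getD, h2, Option.getD_some]
  split_ifs with h <;> simp [Tells, h]

/-! ### The program -/

namespace Expr

/-- `a ≤ b` -/
def le (a b : Expr) : Expr := .sub (.const 1) (.sub a b)

/-- `a = b` -/
def eq (a b : Expr) : Expr := .sub (.const 1) (.add (.sub a b) (.sub b a))

/-- `a < b` -/
def lt (a b : Expr) : Expr := .le (.add a (.const 1)) b

/-- negation -/
def not (a : Expr) : Expr := .sub (.const 1) a

/-- the conjunction of `a` and `b` -/
def and (a b : Expr) : Expr := .ite a b (.const 0)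

/-- the conjunction of the negation of `a` and `b` -/
def notAnd (a b : Expr) : Expr := .ite a (.const 0) b

/-- the truth value of `a ≠ 0` -/
def pos (a : Expr) : Expr := .ite a (.const 1) (.const 0)

/-- the disjunction of `a` and `b` -/
def or (a b : Expr) : Expr := .ite a (.const 1) b

/-- Is there an arc from the vertex in register `x` to the vertex in register `y`? -/
def adj (x y : ℕ) : Expr :=
  .input (.add (.add (.const 3) (.sum 14 (.reg 1) (.and (.lt (.reg 14) (.reg x)) (.reg 1))))
    (.reg y))

/-- The number of vertices in the set that the array `a` represents. -/
def count (a : Fin 3) : Expr := .sum 20 (.reg 1) (.get a (.reg 20))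

end Expr

/-- Fill the array `a` with the values of `e`, where `x` runs through the vertices. -/
def fill (a : Fin 3) (x : ℕ) (e : Expr) : Cmd := .loop x (.reg 1) (.store a (.reg x) e)

/-- Delete vertices without out-neighbours from the set in array `1`, as long as there are any. -/
def peel : Cmd :=
  .loop 11 (.reg 1) (fill 1 12 (.and (.get 1 (.reg 12)) (.pos (.sum 13 (.reg 1)
    (.and (.get 1 (.reg 13)) (.adj 12 13))))))

/-! ### Meaning of elementary expressions, array fills and peeling -/

section Basic

variable {x : Inst} {s : Store}

/-- The array `a` represents the vertex set `U`. -/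
def Holds {n : ℕ} (s : Store) (a : Fin 3) (U : Finset (Fin n)) : Prop :=
  ∀ v : Fin n, Tells (s.arr a v) (v ∈ U)

theorem Holds.of_arr_eq {n : ℕ} {s s' : Store} {a : Fin 3} {U : Finset (Fin n)} (h : Holds s a U)
    (hs : s'.arr a = s.arr a) : Holds s' a U := by
  intro v
  rw [hs]
  exact h v

/-- Register `14` is excluded for `a` because it is the summation variable in the product of row
number and `n`. -/
theorem Expr.tells_adj {a b : ℕ} (ha : a ≠ 14) (hn : s.reg 1 = x.n) {v w : Fin x.n}
    (hv : s.reg a = v) (hw : s.reg b = w) :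
    Tells ((Expr.adj a b).eval x.encode s) (x.D.Adj v w) := by
  have h := sum_range_ite_lt v.2.le x.n
  simp only [Expr.adj, Expr.eval, Expr.and, Expr.lt, Expr.le, Store.setReg_reg, ha, hn, hv, hw,
    if_true, if_false, OfNat.one_ne_ofNat]
  rw [h]
  exact x.tells_encode v w

theorem Expr.tells_and {a b : Expr} {p q : Prop} {inp : List ℕ} (ha : a.eval inp s ≠ 0 ↔ p)
    (hb : Tells (b.eval inp s) q) : Tells ((Expr.and a b).eval inp s) (p ∧ q) :=
  Tells.and ha hb

theorem Expr.tells_notAnd {a b : Expr} {p q : Prop} {inp : List ℕ} (ha : a.eval inp s ≠ 0 ↔ p)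
    (hb : Tells (b.eval inp s) q) : Tells ((Expr.notAnd a b).eval inp s) (¬ p ∧ q) :=
  Tells.not_and ha hb

theorem Expr.tells_or {a b : Expr} {p q : Prop} {inp : List ℕ} (ha : a.eval inp s ≠ 0 ↔ p)
    (hb : Tells (b.eval inp s) q) : Tells ((Expr.or a b).eval inp s) (p ∨ q) :=
  Tells.or ha hb

theorem Expr.tells_pos {a : Expr} {p : Prop} {inp : List ℕ} (ha : a.eval inp s ≠ 0 ↔ p) :
    Tells ((Expr.pos a).eval inp s) p :=
  Tells.of_ne_zero ha

theorem Expr.tells_not {a : Expr} {p : Prop} {inp : List ℕ} (ha : a.eval inp s ≠ 0 ↔ p) :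
    Tells ((Expr.not a).eval inp s) (¬ p) :=
  Tells.not ha

theorem Expr.tells_le (a b : Expr) (inp : List ℕ) (s : Store) :
    Tells ((Expr.le a b).eval inp s) (a.eval inp s ≤ b.eval inp s) :=
  InBranchingPartition.tells_le _ _

theorem Expr.tells_lt (a b : Expr) (inp : List ℕ) (s : Store) :
    Tells ((Expr.lt a b).eval inp s) (a.eval inp s < b.eval inp s) :=
  InBranchingPartition.tells_le _ _

theorem Expr.tells_eq (a b : Expr) (inp : List ℕ) (s : Store) :
    Tells ((Expr.eq a b).eval inp s) (a.eval inp s = b.eval inp s) :=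
  InBranchingPartition.tells_eq _ _

theorem Expr.sum_ne_zero_iff {y n : ℕ} {e : Expr} {inp : List ℕ} {p : Fin n → Prop}
    (hn : s.reg 1 = n) (h : ∀ i : Fin n, e.eval inp (s.setReg y i) ≠ 0 ↔ p i) :
    (Expr.sum y (.reg 1) e).eval inp s ≠ 0 ↔ ∃ i, p i := by
  rw [Expr.eval, show (Expr.reg 1).eval inp s = n from hn]
  exact sum_range_ne_zero_iff h

theorem Expr.eval_count {a : Fin 3} (hn : s.reg 1 = x.n) {U : Finset (Fin x.n)} (h : Holds s a U) :
    (Expr.count a).eval x.encode s = U.card := by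
  simp only [Expr.count, Expr.eval, Store.setReg_reg, if_true, hn]
  exact sum_range_eq_card h

/-- The loop writes only to `y` and `a`, so `e` has to be correct in every store that agrees with
`s` elsewhere. Expressions that read `a` need another argument, as in `sweep_spec`. -/
theorem holds_fill {a : Fin 3} {y : ℕ} {e : Expr} {U : Finset (Fin x.n)} (hn : s.reg 1 = x.n)
    (he : ∀ s' : Store, (∀ z, z ≠ y → s'.reg z = s.reg z) → (∀ b, b ≠ a → s'.arr b = s.arr b) →
      ∀ v : Fin x.n, s'.reg y = v → Tells (e.eval x.encode s') (v ∈ U)) :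
    Holds ((fill a y e).run x.encode s) a U := by
  -- The vacuous condition `v.1 < x.n` is the loop invariant at its last index; the same device
  -- recurs below.
  have key : let s' := (fill a y e).run x.encode s
      (∀ z, z ≠ y → s'.reg z = s.reg z) ∧ (∀ b, b ≠ a → s'.arr b = s.arr b) ∧
        ∀ v : Fin x.n, v.1 < x.n → Tells (s'.arr a v) (v ∈ U) := by
    simp only [fill, Cmd.run, Expr.eval, hn]
    apply iter_induction (p := fun i (s' : Store) => (∀ z, z ≠ y → s'.reg z = s.reg z) ∧
      (∀ b, b ≠ a → s'.arr b = s.arr b) ∧ ∀ v : Fin x.n, v.1 < i → Tells (s'.arr a v) (v ∈ U))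
    · exact ⟨fun _ _ => rfl, fun _ _ => rfl, fun v hv => absurd hv (Nat.not_lt_zero _)⟩
    · rintro i hi s' ⟨h1, h2, h3⟩
      have h1' : ∀ z, z ≠ y → (s'.setReg y i).reg z = s.reg z := by
        intro z hz
        rw [Store.setReg_reg, if_neg hz, h1 z hz]
      refine ⟨h1', fun b hb => ?_, fun v hv => ?_⟩
      · ext j
        rw [Store.setArr_arr, if_neg (fun h => hb h.1), Store.setReg_arr, h2 b hb]
      · rw [Store.setArr_arr, Store.setReg_reg, if_pos rfl]
        by_cases hvi : v.1 = i
        · rw [if_pos ⟨rfl, hvi⟩]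
          exact he _ h1' h2 v (by rw [Store.setReg_reg, if_pos rfl, hvi])
        · rw [if_neg (fun h => hvi h.2)]
          exact h3 v (by omega)
  exact fun v => key.2.2 v v.2

theorem holds_setArr {a : Fin 3} {U W : Finset (Fin x.n)} (h : Holds s a U) (v : Fin x.n) {b : ℕ}
    (hb : Tells b (v ∈ W)) (hW : ∀ u, u ≠ v → (u ∈ W ↔ u ∈ U)) : Holds (s.setArr a v b) a W := by
  intro u
  rw [Store.setArr_arr]
  by_cases hu : u = v
  · subst hu
    rwa [if_pos ⟨rfl, rfl⟩]
  · rw [if_neg (fun h' => hu (Fin.ext h'.2))]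
    exact (h u).congr (hW u hu).symm

/-- Deletion happens in place, so each vertex is tested against a set that may already have shrunk.
A live `L` inside the set never loses a vertex, and a sweep that deletes nothing has tested all
vertices against the same set. -/
theorem sweep_spec {U L : Finset (Fin x.n)} (hn : s.reg 1 = x.n) (h : Holds s 1 U) (hLU : L ⊆ U)
    (hL : IsLive x.D.Adj L) : ∃ W, Holds ((fill 1 12 (.and (.get 1 (.reg 12)) (.pos (.sum 13 (.reg 1)
      (.and (.get 1 (.reg 13)) (.adj 12 13)))))).run x.encode s) 1 W ∧
      L ⊆ W ∧ W ⊆ U ∧ (W = U → IsLive x.D.Adj W) := by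
  classical
  have key : let s' := (fill 1 12 (.and (.get 1 (.reg 12)) (.pos (.sum 13 (.reg 1)
      (.and (.get 1 (.reg 13)) (.adj 12 13)))))).run x.encode s
      s'.reg 1 = x.n ∧ ∃ W, Holds s' 1 W ∧ L ⊆ W ∧ W ⊆ U ∧ (W = U → ∀ v ∈ W, v.1 < x.n →
        ∃ w ∈ W, x.D.Adj v w) := by
    simp only [fill, Cmd.run]
    rw [show (Expr.reg 1).eval x.encode s = x.n from hn]
    apply iter_induction (p := fun i (s' : Store) => s'.reg 1 = x.n ∧ ∃ W, Holds s' 1 W ∧ L ⊆ W ∧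
      W ⊆ U ∧ (W = U → ∀ v ∈ W, v.1 < i → ∃ w ∈ W, x.D.Adj v w))
    · exact ⟨hn, U, h, hLU, le_rfl, fun _ v _ hv => absurd hv (Nat.not_lt_zero _)⟩
    · rintro i hi s' ⟨hn', W, hW, hLW, hWU, hWl⟩
      let v : Fin x.n := ⟨i, hi⟩
      refine ⟨by simpa [Store.setReg_reg] using hn', W.filter fun u => u = v → ∃ w ∈ W, x.D.Adj u w,
        ?_, ?_, ?_, ?_⟩
      · have hW' : Holds (s'.setReg 12 i) 1 W := hW
        refine holds_setArr hW' v ?_ ?_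
        · have hadj : (Expr.sum 13 (.reg 1) (.and (.get 1 (.reg 13)) (.adj 12 13))).eval x.encode
              (s'.setReg 12 i) ≠ 0 ↔ ∃ w, w ∈ W ∧ x.D.Adj v w := by
            refine Expr.sum_ne_zero_iff (by simpa [Store.setReg_reg] using hn') fun w => ?_
            refine (Expr.tells_and (p := w ∈ W) ?_ (Expr.tells_adj (v := v) (w := w) (by norm_num)
              ?_ ?_ ?_)).ne_zero
            · simpa [Expr.eval, Store.setReg_reg] using (hW w).ne_zero
            all_goals simp [Store.setReg_reg, hn', v]
          refine (Expr.tells_and (p := v ∈ W) ?_ (Expr.tells_pos hadj)).congr ?_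
          · simpa [Expr.eval, Store.setReg_reg] using (hW v).ne_zero
          · simp
        · intro u hu
          simp [hu]
      · intro u hu
        refine Finset.mem_filter.2 ⟨hLW hu, fun _ => ?_⟩
        obtain ⟨w, hw, huw⟩ := hL u hu
        exact ⟨w, hLW hw, huw⟩
      · exact (Finset.filter_subset _ _).trans hWU
      · intro heq
        have hWeq : W = U := le_antisymm hWU (heq ▸ Finset.filter_subset _ _)
        rw [heq, ← hWeq]
        intro u hu hui
        by_cases hv : u = v
        · rw [← hWeq] at heq
          rw [← heq] at hu
          exact (Finset.mem_filter.1 hu).2 hv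
        · refine hWl hWeq u hu ?_
          have : u.1 ≠ i := fun h => hv (Fin.ext h)
          omega
  obtain ⟨-, W, h1, h2, h3, h4⟩ := key
  exact ⟨W, h1, h2, h3, fun hWU v hv => h4 hWU v hv v.2⟩

/-- Each sweep leaves a live set or deletes a vertex, so `n` sweeps suffice. The result is live and
contains the core, hence equals it. -/
theorem peel_spec {U : Finset (Fin x.n)} (hn : s.reg 1 = x.n) (h : Holds s 1 U) :
    Holds (peel.run x.encode s) 1 (liveCore x.D.Adj U) := by
  have key : let s' := peel.run x.encode s
      s'.reg 1 = x.n ∧ ∃ W, Holds s' 1 W ∧ liveCore x.D.Adj U ⊆ W ∧ W ⊆ U ∧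
        (IsLive x.D.Adj W ∨ W.card + x.n ≤ x.n) := by
    rw [peel, Cmd.run, show (Expr.reg 1).eval x.encode s = x.n from hn]
    apply iter_induction (p := fun i (s' : Store) => s'.reg 1 = x.n ∧ ∃ W, Holds s' 1 W ∧
      liveCore x.D.Adj U ⊆ W ∧ W ⊆ U ∧ (IsLive x.D.Adj W ∨ W.card + i ≤ x.n))
    · exact ⟨hn, U, h, liveCore_subset U, le_rfl, Or.inr (by simpa using U.card_le_univ)⟩
    · rintro i - s' ⟨hn', W, hW, hLW, hWU, hWl⟩
      have hn'' : (s'.setReg 11 i).reg 1 = x.n := by simpa [Store.setReg_reg] using hn'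
      obtain ⟨W', h1, h2, h3, h4⟩ := sweep_spec (s := s'.setReg 11 i) hn'' hW hLW
        (isLive_liveCore U)
      refine ⟨?_, W', h1, h2, h3.trans hWU, ?_⟩
      · rw [Cmd.run_reg _ _ (by decide), hn'']
      · by_cases heq : W' = W
        · exact Or.inl (h4 heq)
        · rcases hWl with hl | hc
          · exact absurd (le_antisymm h3 ((hl.subset_liveCore hWU).trans h2)) heq
          · have := Finset.card_lt_card (h3.ssubset_of_ne heq)
            exact Or.inr (by omega)
  obtain ⟨-, W, hW, h1, h2, h3⟩ := key
  have hl : IsLive x.D.Adj W := by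
    rcases h3 with h3 | h3
    · exact h3
    · have : W = ∅ := Finset.card_eq_zero.1 (by omega)
      simp [this, IsLive]
  rwa [le_antisymm h1 (hl.subset_liveCore h2)]

end Basic


/-! ### The search program: candidates, growth steps, trials -/

/-- Compute in array `2` the vertices that may be attached to the set in array `0`. -/
def findCandidates : Cmd :=
  .loop 16 (.reg 1) (.seq
    (fill 1 19 (.notAnd (.get 0 (.reg 19)) (.not (.eq (.reg 19) (.reg 16)))))
    (.seq peel (.store 2 (.reg 16) (.notAnd (.get 0 (.reg 16))
      (.and (.sum 20 (.reg 1) (.and (.get 0 (.reg 20)) (.adj 16 20)))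
        (.le (.reg 3) (.count 1)))))))

/-- Is `x + 1` times the base at most `q`, for the number `x` in register `17`? -/
def multipleLe : Expr :=
  .le (.sum 18 (.reg 5) (.and (.lt (.reg 18) (.add (.reg 17) (.const 1))) (.reg 4))) (.reg 8)

/-- Attach the candidate that the last digit of register `8` selects, and drop that digit. -/
def growStep : Cmd :=
  -- Array `0` holds the tree, array `1` is scratch space and array `2` holds the candidates.
  -- Register `8` holds the digits not yet used and register `9` the current one.
  .seq findCandidates (.seq
    (.assign 9 (.sub (.reg 8) (.sum 17 (.reg 5) (.and multipleLe (.reg 4))))) (.seq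
    (.assign 8 (.sum 17 (.reg 5) multipleLe)) (.seq
    -- The new tree is assembled in array `1` and then copied, so that no fill reads the array it
    -- writes and `holds_fill` applies.
    (fill 1 19 (.or (.get 0 (.reg 19)) (.and (.get 2 (.reg 19)) (.eq (.sum 20 (.reg 1)
      (.and (.lt (.reg 20) (.reg 19)) (.get 2 (.reg 20)))) (.reg 9)))))
    (fill 0 19 (.get 1 (.reg 19))))))

/-- Test a single root (register `6`) and a single sequence of choices (register `7`). -/
def trial : Cmd :=
  .seq (fill 0 19 (.eq (.reg 19) (.reg 6))) (.seq
    (.assign 8 (.reg 7)) (.seq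
    (.loop 15 (.reg 2) growStep) (.seq
    (fill 1 19 (.not (.get 0 (.reg 19)))) (.seq
    peel
    (.assign 0 (.or (.reg 0) (.and
      (.not (.sum 21 (.reg 1) (.notAnd (.eq (.reg 21) (.reg 6))
        (.not (.sum 20 (.reg 1) (.adj 21 20))))))
      (.and (.lt (.reg 2) (.count 0)) (.le (.reg 3) (.count 1))))))))))

/-- Test all roots and all sequences of choices. -/
def search : Cmd := .loop 6 (.reg 1) (.loop 7 (.reg 5) trial)

/-- Read the numbers in the input. -/
def prepare : Cmd :=
  .seq (.assign 1 (.input (.const 0))) (.seq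
    (.assign 10 (.input (.const 1))) (.seq
    (.assign 2 (.sub (.reg 10) (.const 1))) (.seq
    (.assign 3 (.input (.const 2))) (.seq
    (.assign 4 (.add (.add (.add (.add (.reg 2) (.reg 2)) (.add (.reg 2) (.reg 2)))
      (.add (.reg 3) (.reg 3))) (.const 1))) (.seq
    (.assign 5 (.const 1))
    (.assign 0 (.const 0)))))))

/-- Compute the number of sequences of choices. -/
def computePower : Cmd := .loop 15 (.reg 2) (.assign 5 (.sum 17 (.reg 4) (.reg 5)))

/-- The case of an empty first part. -/
def tryEmpty : Cmd :=
  .assign 0 (.or (.reg 0) (.notAnd (.reg 10) (.notAnd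
    (.sum 21 (.reg 1) (.not (.sum 20 (.reg 1) (.adj 21 20)))) (.le (.reg 3) (.reg 1)))))

/-- The number of choices. -/
def Inst.rounds (x : Inst) : ℕ := x.k₁ - 1

/-- The number of alternatives for each choice. -/
def Inst.width (x : Inst) : ℕ := 4 * x.rounds + 2 * x.k₂ + 1

/-- The registers contain the numbers that the search depends on. -/
structure Params (x : Inst) (s : Store) : Prop where
  n : s.reg 1 = x.n
  rounds : s.reg 2 = x.rounds
  k₂ : s.reg 3 = x.k₂
  width : s.reg 4 = x.width
  total : s.reg 5 = x.width ^ x.rounds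

theorem Cmd.run_seq (inp : List ℕ) (c₁ c₂ : Cmd) (s : Store) :
    (Cmd.seq c₁ c₂).run inp s = c₂.run inp (c₁.run inp s) := rfl

theorem Params.congr {x : Inst} {s s' : Store} (h : Params x s)
    (hs : ∀ y ∈ [1, 2, 3, 4, 5], s'.reg y = s.reg y) : Params x s' :=
  ⟨(hs 1 (by simp)).trans h.n, (hs 2 (by simp)).trans h.rounds, (hs 3 (by simp)).trans h.k₂,
    (hs 4 (by simp)).trans h.width, (hs 5 (by simp)).trans h.total⟩

theorem Params.run {x : Inst} {s : Store} (h : Params x s) (c : Cmd)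
    (hc : ∀ y ∈ [1, 2, 3, 4, 5], y ∉ c.regs) : Params x (c.run x.encode s) :=
  h.congr fun y hy => Cmd.run_reg _ _ (hc y hy) s

theorem Params.setReg {x : Inst} {s : Store} (h : Params x s) {y : ℕ} (v : ℕ)
    (hy : y ∉ [1, 2, 3, 4, 5]) : Params x (s.setReg y v) :=
  h.congr fun z hz => by
    rw [Store.setReg_reg, if_neg]
    rintro rfl
    exact hy hz

/-! ### Correctness of the search program -/

section Semantics

variable {x : Inst} {s : Store}

theorem findCandidates_spec {T : Finset (Fin x.n)} (hs : Params x s) (hT : Holds s 0 T) :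
    Holds (findCandidates.run x.encode s) 2 (candidates x.D.Adj x.k₂ T) := by
  have key : let s' := findCandidates.run x.encode s
      Params x s' ∧ Holds s' 0 T ∧
        ∀ v : Fin x.n, v.1 < x.n → Tells (s'.arr 2 v) (v ∈ candidates x.D.Adj x.k₂ T) := by
    rw [findCandidates, Cmd.run, show (Expr.reg 1).eval x.encode s = x.n from hs.n]
    apply iter_induction (p := fun i (s' : Store) => Params x s' ∧ Holds s' 0 T ∧
        ∀ v : Fin x.n, v.1 < i → Tells (s'.arr 2 v) (v ∈ candidates x.D.Adj x.k₂ T))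
    · exact ⟨hs, hT, fun v hv => absurd hv (Nat.not_lt_zero _)⟩
    · rintro i hi s' ⟨hs', hT', hC⟩
      let v : Fin x.n := ⟨i, hi⟩
      simp only [Cmd.run_seq]
      have hs₁ : Params x (s'.setReg 16 i) := hs'.setReg i (by decide)
      have hT₁ : Holds (s'.setReg 16 i) 0 T := hT'
      have hC₁ : ∀ v : Fin x.n, v.1 < i →
        Tells ((s'.setReg 16 i).arr 2 v) (v ∈ candidates x.D.Adj x.k₂ T) := hC
      have hv₁ : (s'.setReg 16 i).reg 16 = v := by simp [Store.setReg_reg, v]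
      -- Each intermediate store is made opaque once the facts needed later are recorded:
      -- parameters, tree, finished candidates and current vertex.
      generalize s'.setReg 16 i = s₁ at *
      have hA : Holds ((fill 1 19 (.notAnd (.get 0 (.reg 19))
          (.not (.eq (.reg 19) (.reg 16))))).run x.encode s₁) 1 (insert v T)ᶜ := by
        refine holds_fill hs₁.n fun s₂ h1 h2 u hu => ?_
        refine (Expr.tells_notAnd (p := u ∈ T) (q := ¬ u = v) ?_ (Expr.tells_not ?_)).congr ?_
        · rw [Expr.eval, h2 0 (by decide), show (Expr.reg 19).eval x.encode s₂ = u from hu]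
          exact (hT₁ u).ne_zero
        · refine (Tells.congr (Expr.tells_eq _ _ _ _) ?_).ne_zero
          simp only [Expr.eval]
          rw [hu, h1 16 (by decide), hv₁, Fin.ext_iff]
        · simp [and_comm]
      have hs₂ := hs₁.run (fill 1 19 (.notAnd (.get 0 (.reg 19))
          (.not (.eq (.reg 19) (.reg 16))))) (by decide)
      have hT₂ := hT₁.of_arr_eq (Cmd.run_arr x.encode (fill 1 19 (.notAnd (.get 0 (.reg 19))
          (.not (.eq (.reg 19) (.reg 16))))) (a := 0) (by decide) s₁)
      have hC₂ := Cmd.run_arr x.encode (fill 1 19 (.notAnd (.get 0 (.reg 19))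
          (.not (.eq (.reg 19) (.reg 16))))) (a := 2) (by decide) s₁
      have hv₂ := Cmd.run_reg x.encode (fill 1 19 (.notAnd (.get 0 (.reg 19))
          (.not (.eq (.reg 19) (.reg 16))))) (x := 16) (by decide) s₁
      rw [hv₁] at hv₂
      rw [← hC₂] at hC₁
      generalize (fill 1 19 (.notAnd (.get 0 (.reg 19))
          (.not (.eq (.reg 19) (.reg 16))))).run x.encode s₁ = s₂ at *
      have hA₃ := peel_spec hs₂.n hA
      have hs₃ := hs₂.run peel (by decide)
      have hT₃ := hT₂.of_arr_eq (Cmd.run_arr x.encode peel (a := 0) (by decide) s₂)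
      have hC₃ := Cmd.run_arr x.encode peel (a := 2) (by decide) s₂
      have hv₃ := Cmd.run_reg x.encode peel (x := 16) (by decide) s₂
      rw [hv₂] at hv₃
      rw [← hC₃] at hC₁
      generalize peel.run x.encode s₂ = s₃ at *
      rw [Cmd.run]
      refine ⟨hs₃.congr fun _ _ => rfl, fun u => by simpa [Store.setArr_arr] using hT₃ u, fun u hu => ?_⟩
      rw [Store.setArr_arr]
      by_cases hui : u.1 = i
      · obtain rfl : u = v := Fin.ext hui
        rw [if_pos ⟨rfl, hv₃.symm⟩]
        refine (Expr.tells_notAnd (p := v ∈ T) (q := (∃ w, w ∈ T ∧ x.D.Adj v w) ∧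
          x.k₂ ≤ (liveCore x.D.Adj (insert v T)ᶜ).card) ?_
          (Expr.tells_and ?_ ((Expr.tells_le _ _ _ _).congr ?_))).congr mem_candidates.symm
        · simpa [Expr.eval, hv₃] using (hT₃ v).ne_zero
        · refine Expr.sum_ne_zero_iff hs₃.n fun w => ?_
          refine (Expr.tells_and (p := w ∈ T) ?_ (Expr.tells_adj (v := v) (w := w) (by norm_num)
              ?_ ?_ ?_)).ne_zero
          · simpa [Expr.eval, Store.setReg_reg] using (hT₃ w).ne_zero
          all_goals simp [Store.setReg_reg, hs₃.n, hv₃]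
        · rw [Expr.eval_count hs₃.n hA₃, Expr.eval, hs₃.k₂]
      · rw [if_neg]
        · exact hC₁ u (by omega)
        · rintro ⟨-, h⟩
          exact hui (h.trans hv₃)
  exact fun v => key.2.2 v v.2

/-- Division by counting: `(i + 1) * width ≤ q` holds exactly for the `i` below `q / width`, so
summing these truth values gives the quotient. -/
theorem tells_multipleLe (hs : Params x s) (i : ℕ) (hi : i < x.width ^ x.rounds) :
    Tells (multipleLe.eval x.encode (s.setReg 17 i)) (i < s.reg 8 / x.width) := by
  refine (Expr.tells_le _ _ _ _).congr ?_
  have h := sum_range_ite_lt (n := x.width ^ x.rounds) (a := i + 1) (by omega) x.width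
  simp only [Expr.eval, Expr.and, Expr.lt, Expr.le, Store.setReg_reg]
  norm_num
  simp only [hs.total, hs.width]
  rw [h, ← Nat.le_div_iff_mul_le (by simp [Inst.width])]
  omega

/-- The bound on register `8` ensures that the quotient does not exceed the range `width ^ rounds`
of the counting sum. -/
theorem growStep_spec {T : Finset (Fin x.n)} (hs : Params x s) (hT : Holds s 0 T)
    (hq : s.reg 8 ≤ x.width ^ x.rounds) :
    Holds (growStep.run x.encode s) 0 (attach x.D.Adj x.k₂ (s.reg 8 % x.width) T) ∧
      (growStep.run x.encode s).reg 8 = s.reg 8 / x.width := by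
  have hquot : ∀ (s : Store) (c : ℕ) (e : Expr), Params x s → s.reg 8 ≤ x.width ^ x.rounds →
      (∀ i, e.eval x.encode (s.setReg 17 i) = c) →
      (Expr.sum 17 (.reg 5) (.and multipleLe e)).eval x.encode s = s.reg 8 / x.width * c := by
    intro s c e hs hq he
    rw [Expr.eval, show (Expr.reg 5).eval x.encode s = x.width ^ x.rounds from hs.total,
      ← sum_range_ite_lt ((Nat.div_le_self _ _).trans hq)]
    refine Finset.sum_congr rfl fun i hi => ?_
    have h1 := tells_multipleLe hs i (Finset.mem_range.1 hi)
    simp only [Expr.and, Expr.eval, he]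
    rcases h1 with ⟨h1, h2⟩ | ⟨h1, h2⟩
    · rw [h1, if_neg one_ne_zero, if_neg (by omega)]
    · rw [h1, if_pos rfl, if_pos (by omega)]
  simp only [growStep, Cmd.run_seq]
  have hC := findCandidates_spec hs hT
  have hs₁ := hs.run findCandidates (by decide)
  have hT₁ := hT.of_arr_eq (Cmd.run_arr x.encode findCandidates (a := 0) (by decide) s)
  have hq₁ := Cmd.run_reg x.encode findCandidates (x := 8) (by decide) s
  rw [← hq₁] at hq ⊢
  generalize findCandidates.run x.encode s = s₁ at *
  have hrem : (Expr.sub (.reg 8) (.sum 17 (.reg 5) (.and multipleLe (.reg 4)))).eval x.encode s₁ =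
      s₁.reg 8 % x.width := by
    rw [Expr.eval, hquot s₁ x.width _ hs₁ hq fun i => by simp [Expr.eval, Store.setReg_reg, hs₁.width],
      Nat.mod_eq_sub_div_mul]
    rfl
  rw [show (Cmd.assign 9 _).run x.encode s₁ = s₁.setReg 9 (s₁.reg 8 % x.width) by
    rw [← hrem]; rfl]
  have hs₂ := hs₁.setReg (y := 9) (s₁.reg 8 % x.width) (by decide)
  have hq₂ : (s₁.setReg 9 (s₁.reg 8 % x.width)).reg 8 = s₁.reg 8 := by
    simp [Store.setReg_reg]
  have hdiv : (Expr.sum 17 (.reg 5) multipleLe).eval x.encode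
      (s₁.setReg 9 (s₁.reg 8 % x.width)) = s₁.reg 8 / x.width := by
    have h := hquot _ 1 (.const 1) hs₂ (hq₂.trans_le hq) fun i => rfl
    rw [mul_one, hq₂] at h
    rw [← h, Expr.eval, Expr.eval]
    refine Finset.sum_congr rfl fun i hi => ?_
    have h1 := tells_multipleLe hs₂ i (by
      rw [show (Expr.reg 5).eval x.encode _ = x.width ^ x.rounds from hs₂.total] at hi
      exact Finset.mem_range.1 hi)
    simp only [Expr.and, Expr.eval]
    rcases h1 with ⟨h1, -⟩ | ⟨h1, -⟩ <;> simp [h1]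
  rw [show (Cmd.assign 8 _).run x.encode (s₁.setReg 9 (s₁.reg 8 % x.width)) =
    (s₁.setReg 9 (s₁.reg 8 % x.width)).setReg 8 (s₁.reg 8 / x.width) by rw [← hdiv]; rfl]
  have hb : ((s₁.setReg 9 (s₁.reg 8 % x.width)).setReg 8 (s₁.reg 8 / x.width)).reg 9 =
      s₁.reg 8 % x.width := by simp [Store.setReg_reg]
  have hd : ((s₁.setReg 9 (s₁.reg 8 % x.width)).setReg 8 (s₁.reg 8 / x.width)).reg 8 =
      s₁.reg 8 / x.width := by simp [Store.setReg_reg]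
  have hs₃ := hs₂.setReg (y := 8) (s₁.reg 8 / x.width) (by decide)
  have hT₃ : Holds ((s₁.setReg 9 (s₁.reg 8 % x.width)).setReg 8 (s₁.reg 8 / x.width)) 0 T := hT₁
  have hC₃ : Holds ((s₁.setReg 9 (s₁.reg 8 % x.width)).setReg 8 (s₁.reg 8 / x.width)) 2
    (candidates x.D.Adj x.k₂ T) := hC
  generalize s₁.reg 8 % x.width = b at *
  generalize (s₁.setReg 9 b).setReg 8 (s₁.reg 8 / x.width) = s₃ at *
  constructor
  · refine holds_fill ?_ fun s₅ h1 h2 u hu => ?_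
    · rw [Cmd.run_reg _ _ (by decide), hs₃.n]
    · rw [Expr.eval, h2 1 (by decide), show (Expr.reg 19).eval x.encode s₅ = u from hu]
      refine holds_fill (a := 1) (U := attach x.D.Adj x.k₂ b T) hs₃.n ?_ u
      clear h1 h2 hu u s₅
      intro s₄ h1 h2 v hv
      have hT₄ : Holds s₄ 0 T := hT₃.of_arr_eq (h2 0 (by decide))
      have hC₄ : Holds s₄ 2 (candidates x.D.Adj x.k₂ T) := hC₃.of_arr_eq (h2 2 (by decide))
      refine (Expr.tells_or (p := v ∈ T) (q := v ∈ candidates x.D.Adj x.k₂ T ∧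
        rankIn (candidates x.D.Adj x.k₂ T) v = b) ?_ (Expr.tells_and ?_
        ((Expr.tells_eq _ _ _ _).congr ?_))).congr ?_
      · simpa [Expr.eval, hv] using (hT₄ v).ne_zero
      · simpa [Expr.eval, hv] using (hC₄ v).ne_zero
      · rw [Expr.eval, Expr.eval, Expr.eval, h1 9 (by decide), hb, h1 1 (by decide), hs₃.n,
          sum_range_eq_card (U := (candidates x.D.Adj x.k₂ T).filter (· < v))]
        · rfl
        · intro u
          refine (Expr.tells_and (p := u < v) (q := u ∈ candidates x.D.Adj x.k₂ T)
            (Tells.congr (Expr.tells_lt _ _ _ _) ?_).ne_zero ?_).congr ?_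
          · simp [Expr.eval, Store.setReg_reg, hv]
          · simpa [Expr.eval, Store.setReg_reg] using hC₄ u
          · simp [and_comm]
      · simp [attach]
  · rw [Cmd.run_reg _ _ (by decide), Cmd.run_reg _ _ (by decide), hd]

/-- The invariant is that growing the current tree for the remaining rounds with the remaining
digits gives the fixed final tree. -/
theorem growLoop_spec {T : Finset (Fin x.n)} (hs : Params x s) (hT : Holds s 0 T)
    (hq : s.reg 8 ≤ x.width ^ x.rounds) :
    Holds ((Cmd.loop 15 (.reg 2) growStep).run x.encode s) 0
      (grow x.D.Adj x.k₂ x.width x.rounds T (s.reg 8)) := by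
  have key : let s' := (Cmd.loop 15 (.reg 2) growStep).run x.encode s
      Params x s' ∧ s'.reg 8 ≤ x.width ^ x.rounds ∧ ∃ T', Holds s' 0 T' ∧
        grow x.D.Adj x.k₂ x.width (x.rounds - x.rounds) T' (s'.reg 8) =
          grow x.D.Adj x.k₂ x.width x.rounds T (s.reg 8) := by
    rw [Cmd.run, show (Expr.reg 2).eval x.encode s = x.rounds from hs.rounds]
    apply iter_induction (p := fun i (s' : Store) =>
      Params x s' ∧ s'.reg 8 ≤ x.width ^ x.rounds ∧ ∃ T', Holds s' 0 T' ∧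
        grow x.D.Adj x.k₂ x.width (x.rounds - i) T' (s'.reg 8) =
          grow x.D.Adj x.k₂ x.width x.rounds T (s.reg 8))
    · exact ⟨hs, hq, T, hT, rfl⟩
    · rintro i hi s' ⟨hs', hq', T', hT', h⟩
      have hs₁ := hs'.setReg (y := 15) i (by decide)
      have hr : (s'.setReg 15 i).reg 8 = s'.reg 8 := by simp [Store.setReg_reg]
      have hT₁ : Holds (s'.setReg 15 i) 0 T' := hT'
      rw [← hr] at hq' h
      generalize s'.setReg 15 i = s₁ at *
      obtain ⟨h1, h2⟩ := growStep_spec hs₁ hT₁ hq'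
      refine ⟨hs₁.run _ (by decide), ?_, _, h1, ?_⟩
      · rw [h2]
        exact (Nat.div_le_self _ _).trans hq'
      · rw [h2, ← h, show x.rounds - i = x.rounds - (i + 1) + 1 by omega]
        rfl
  obtain ⟨-, -, T', hT', h⟩ := key
  rw [Nat.sub_self] at h
  rw [← h]
  exact hT'

/-- The search succeeds with the root `v` and the sequence `q` of choices. -/
def Inst.Succeeds (x : Inst) (v : Fin x.n) (q : ℕ) : Prop :=
  (∀ u, u ≠ v → ∃ w, x.D.Adj u w) ∧
    x.rounds < (grow x.D.Adj x.k₂ x.width x.rounds {v} q).card ∧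
    x.k₂ ≤ (liveCore x.D.Adj (grow x.D.Adj x.k₂ x.width x.rounds {v} q)ᶜ).card

theorem tells_hasOut {a : ℕ} {u : Fin x.n} (hs : s.reg 1 = x.n) (ha : a ≠ 14) (ha' : a ≠ 20)
    (hu : s.reg a = u) :
    (Expr.sum 20 (.reg 1) (.adj a 20)).eval x.encode s ≠ 0 ↔ ∃ w, x.D.Adj u w := by
  refine Expr.sum_ne_zero_iff hs fun w => (Expr.tells_adj ha ?_ ?_ ?_).ne_zero
  · simpa [Store.setReg_reg] using hs
  · simpa [Store.setReg_reg, ha'] using hu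
  · simp [Store.setReg_reg]

/-- Register `0` collects a disjunction; `p` stands for what the earlier trials have contributed. -/
theorem trial_spec {v : Fin x.n} {p : Prop} (hs : Params x s) (hv : s.reg 6 = v)
    (hq : s.reg 7 < x.width ^ x.rounds) (h0 : Tells (s.reg 0) p) :
    Tells ((trial.run x.encode s).reg 0) (p ∨ x.Succeeds v (s.reg 7)) := by
  simp only [trial, Cmd.run_seq]
  have hT : Holds ((fill 0 19 (.eq (.reg 19) (.reg 6))).run x.encode s) 0 {v} := by
    refine holds_fill hs.n fun s₁ h1 h2 u hu => (Expr.tells_eq _ _ _ _).congr ?_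
    simp [Expr.eval, h1 6 (by decide), hu, hv, Fin.ext_iff]
  have hs₁ := hs.run (fill 0 19 (.eq (.reg 19) (.reg 6))) (by decide)
  have hf₁ : ∀ y, y ≠ 19 → ((fill 0 19 (.eq (.reg 19) (.reg 6))).run x.encode s).reg y =
      s.reg y := fun y hy => Cmd.run_reg _ _ (by simpa [fill, Cmd.regs] using hy) s
  generalize (fill 0 19 (.eq (.reg 19) (.reg 6))).run x.encode s = s₁ at *
  rw [show (Cmd.assign 8 (.reg 7)).run x.encode s₁ = s₁.setReg 8 (s.reg 7) by
    rw [← hf₁ 7 (by decide)]; rfl]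
  have hs₂ := hs₁.setReg (y := 8) (s.reg 7) (by decide)
  have hT₂ : Holds (s₁.setReg 8 (s.reg 7)) 0 {v} := hT
  have hq₂ : (s₁.setReg 8 (s.reg 7)).reg 8 = s.reg 7 := by simp [Store.setReg_reg]
  have h0₂ : (s₁.setReg 8 (s.reg 7)).reg 0 = s.reg 0 := by
    simp [Store.setReg_reg, hf₁ 0 (by decide)]
  have hv₂ : (s₁.setReg 8 (s.reg 7)).reg 6 = v := by
    simp [Store.setReg_reg, hf₁ 6 (by decide), hv]
  generalize s₁.setReg 8 (s.reg 7) = s₂ at *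
  have hT₃ := growLoop_spec hs₂ hT₂ (hq₂.trans_le hq.le)
  rw [hq₂] at hT₃
  have hs₃ := hs₂.run (.loop 15 (.reg 2) growStep) (by decide)
  have h0₃ := (Cmd.run_reg x.encode (.loop 15 (.reg 2) growStep) (x := 0) (by decide) s₂).trans h0₂
  have hv₃ := (Cmd.run_reg x.encode (.loop 15 (.reg 2) growStep) (x := 6) (by decide) s₂).trans hv₂
  generalize (Cmd.loop 15 (.reg 2) growStep).run x.encode s₂ = s₃ at *
  rw [Inst.Succeeds]
  generalize grow x.D.Adj x.k₂ x.width x.rounds {v} (s.reg 7) = T at *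
  have hA₄ : Holds ((fill 1 19 (.not (.get 0 (.reg 19)))).run x.encode s₃) 1 Tᶜ := by
    refine holds_fill hs₃.n fun s₄ h1 h2 u hu => (Expr.tells_not (p := u ∈ T) ?_).congr ?_
    · simpa [Expr.eval, hu, h2 0 (by decide)] using (hT₃ u).ne_zero
    · simp
  have hT₄ := hT₃.of_arr_eq (Cmd.run_arr x.encode (fill 1 19 (.not (.get 0 (.reg 19)))) (a := 0)
    (by decide) s₃)
  have hs₄ := hs₃.run (fill 1 19 (.not (.get 0 (.reg 19)))) (by decide)
  have h0₄ := (Cmd.run_reg x.encode (fill 1 19 (.not (.get 0 (.reg 19)))) (x := 0)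
    (by decide) s₃).trans h0₃
  have hv₄ := (Cmd.run_reg x.encode (fill 1 19 (.not (.get 0 (.reg 19)))) (x := 6)
    (by decide) s₃).trans hv₃
  generalize (fill 1 19 (.not (.get 0 (.reg 19)))).run x.encode s₃ = s₄ at *
  have hA₅ := peel_spec hs₄.n hA₄
  have hT₅ := hT₄.of_arr_eq (Cmd.run_arr x.encode peel (a := 0) (by decide) s₄)
  have hs₅ := hs₄.run peel (by decide)
  have h0₅ := (Cmd.run_reg x.encode peel (x := 0) (by decide) s₄).trans h0₄
  have hv₅ := (Cmd.run_reg x.encode peel (x := 6) (by decide) s₄).trans hv₄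
  generalize peel.run x.encode s₄ = s₅ at *
  rw [Cmd.run, Store.setReg_reg, if_pos rfl]
  refine Expr.tells_or ?_ (Expr.tells_and ?_ (Expr.tells_and ?_ ?_))
  · rw [Expr.eval, h0₅]
    exact h0.ne_zero
  · have hsum : (Expr.sum 21 (.reg 1) (.notAnd (.eq (.reg 21) (.reg 6))
        (.not (.sum 20 (.reg 1) (.adj 21 20))))).eval x.encode s₅ ≠ 0 ↔
        ∃ u, ¬ u = v ∧ ¬ ∃ w, x.D.Adj u w := by
      refine Expr.sum_ne_zero_iff hs₅.n fun u => (Expr.tells_notAnd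
        (Tells.congr (Expr.tells_eq _ _ _ _) ?_).ne_zero (Expr.tells_not ?_)).ne_zero
      · simp [Expr.eval, Store.setReg_reg, hv₅, Fin.ext_iff]
      · exact tells_hasOut (by simpa [Store.setReg_reg] using hs₅.n) (by decide) (by decide)
          (by simp [Store.setReg_reg])
    refine (Tells.congr (Expr.tells_not hsum) ?_).ne_zero
    push Not
    rfl
  · refine (Tells.congr (Expr.tells_lt _ _ _ _) ?_).ne_zero
    rw [Expr.eval_count hs₅.n hT₅, Expr.eval, hs₅.rounds]
  · refine (Expr.tells_le _ _ _ _).congr ?_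
    rw [Expr.eval_count hs₅.n hA₅, Expr.eval, hs₅.k₂]

theorem search_spec (hs : Params x s) (h0 : s.reg 0 = 0) :
    Tells ((search.run x.encode s).reg 0) (SearchSucceeds x.D.Adj x.rounds x.k₂ x.width) := by
  have key : let s' := search.run x.encode s
      Params x s' ∧ Tells (s'.reg 0) (∃ v : Fin x.n, v.1 < x.n ∧
        ∃ q < x.width ^ x.rounds, x.Succeeds v q) := by
    rw [search, Cmd.run, show (Expr.reg 1).eval x.encode s = x.n from hs.n]
    apply iter_induction (p := fun i (s' : Store) => Params x s' ∧
      Tells (s'.reg 0) (∃ v : Fin x.n, v.1 < i ∧ ∃ q < x.width ^ x.rounds, x.Succeeds v q))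
    · exact ⟨hs, by simp [Tells, h0]⟩
    · rintro i hi s' ⟨hs', h⟩
      let v : Fin x.n := ⟨i, hi⟩
      have inner : let s₂ := (Cmd.loop 7 (.reg 5) trial).run x.encode (s'.setReg 6 i)
          Params x s₂ ∧ s₂.reg 6 = v ∧ Tells (s₂.reg 0)
            ((∃ v : Fin x.n, v.1 < i ∧ ∃ q < x.width ^ x.rounds, x.Succeeds v q) ∨
              ∃ q < x.width ^ x.rounds, x.Succeeds v q) := by
        have hs₁ := hs'.setReg (y := 6) i (by decide)
        rw [Cmd.run, show (Expr.reg 5).eval x.encode (s'.setReg 6 i) = x.width ^ x.rounds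
          from hs₁.total]
        apply iter_induction (p := fun j (s₂ : Store) => Params x s₂ ∧ s₂.reg 6 = v ∧
          Tells (s₂.reg 0)
            ((∃ v : Fin x.n, v.1 < i ∧ ∃ q < x.width ^ x.rounds, x.Succeeds v q) ∨
              ∃ q < j, x.Succeeds v q))
        · refine ⟨hs₁, by simp [Store.setReg_reg, v], ?_⟩
          simpa [Store.setReg_reg] using h
        · rintro j hj s₂ ⟨hs₂, hv₂, h₂⟩
          have hs₃ := hs₂.setReg (y := 7) j (by decide)
          have hv₃ : (s₂.setReg 7 j).reg 6 = v := by simpa [Store.setReg_reg] using hv₂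
          have hj₃ : (s₂.setReg 7 j).reg 7 = j := by simp [Store.setReg_reg]
          have h₃ := trial_spec hs₃ hv₃ (hj₃.trans_lt hj)
            (by simpa [Store.setReg_reg] using h₂)
          refine ⟨hs₃.run trial (by decide), ?_, h₃.congr ?_⟩
          · rw [Cmd.run_reg _ _ (by decide), hv₃]
          · rw [hj₃, or_assoc]
            apply or_congr_right
            constructor
            · rintro (⟨q, hq, h⟩ | h)
              · exact ⟨q, by omega, h⟩
              · exact ⟨j, by omega, h⟩
            · rintro ⟨q, hq, h⟩
              rcases Nat.lt_succ_iff_lt_or_eq.1 hq with hq | rfl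
              · exact Or.inl ⟨q, hq, h⟩
              · exact Or.inr h
      obtain ⟨h1, -, h2⟩ := inner
      refine ⟨h1, h2.congr ?_⟩
      constructor
      · rintro (⟨u, hu, h⟩ | h)
        · exact ⟨u, by omega, h⟩
        · exact ⟨v, Nat.lt_succ_self i, h⟩
      · rintro ⟨u, hu, h⟩
        rcases Nat.lt_succ_iff_lt_or_eq.1 hu with hu | hu
        · exact Or.inl ⟨u, hu, h⟩
        · rw [show u = v from Fin.ext hu] at h
          exact Or.inr h
  refine key.2.congr ⟨?_, ?_⟩
  · rintro ⟨v, -, q, hq, h1, h2⟩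
    exact ⟨v, h1, q, hq, h2⟩
  · rintro ⟨v, h1, q, hq, h2⟩
    exact ⟨v, v.2, q, hq, h1, h2⟩

end Semantics


/-! ### The complete programs and their running time -/

section Final

variable {x : Inst} {s : Store}

theorem prepare_spec (x : Inst) (s : Store) : let s' := prepare.run x.encode s
    s'.reg 0 = 0 ∧ s'.reg 1 = x.n ∧ s'.reg 2 = x.rounds ∧ s'.reg 3 = x.k₂ ∧ s'.reg 4 = x.width ∧
      s'.reg 5 = 1 ∧ s'.reg 10 = x.k₁ := by
  simp [prepare, Cmd.run, Expr.eval, Store.setReg_reg, Inst.encode, Inst.rounds, Inst.width]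
  omega

theorem computePower_spec (h1 : s.reg 1 = x.n) (h2 : s.reg 2 = x.rounds) (h3 : s.reg 3 = x.k₂)
    (h4 : s.reg 4 = x.width) (h5 : s.reg 5 = 1) : Params x (computePower.run x.encode s) := by
  refine ⟨?_, ?_, ?_, ?_, ?_⟩
  · rw [Cmd.run_reg _ _ (by decide), h1]
  · rw [Cmd.run_reg _ _ (by decide), h2]
  · rw [Cmd.run_reg _ _ (by decide), h3]
  · rw [Cmd.run_reg _ _ (by decide), h4]
  · have key : let s' := computePower.run x.encode s
        s'.reg 4 = x.width ∧ s'.reg 5 = x.width ^ x.rounds := by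
      rw [computePower, Cmd.run, show (Expr.reg 2).eval x.encode s = x.rounds from h2]
      apply iter_induction (p := fun i (s' : Store) => s'.reg 4 = x.width ∧
        s'.reg 5 = x.width ^ i)
      · exact ⟨h4, by simpa using h5⟩
      · rintro i - s' ⟨h4, h5⟩
        simp [Cmd.run, Expr.eval, Store.setReg_reg, h4, h5, pow_succ']
    exact key.2

theorem tryEmpty_spec {p : Prop} (hs : Params x s) (h10 : s.reg 10 = x.k₁) (h0 : Tells (s.reg 0) p) :
    Tells ((tryEmpty.run x.encode s).reg 0)
      (p ∨ (x.k₁ = 0 ∧ x.k₂ ≤ x.n ∧ ∀ v, ∃ w, x.D.Adj v w)) := by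
  rw [tryEmpty, Cmd.run, Store.setReg_reg, if_pos rfl]
  refine Expr.tells_or h0.ne_zero ((Expr.tells_notAnd (p := x.k₁ ≠ 0)
    (q := (¬ ∃ v, ¬ ∃ w, x.D.Adj v w) ∧ x.k₂ ≤ x.n) ?_ (Expr.tells_notAnd ?_ ?_)).congr ?_)
  · rw [Expr.eval, h10]
  · refine Expr.sum_ne_zero_iff hs.n fun v => (Expr.tells_not ?_).ne_zero
    exact tells_hasOut (by simpa [Store.setReg_reg] using hs.n) (by decide) (by decide)
      (by simp [Store.setReg_reg])
  · refine (Expr.tells_le _ _ _ _).congr ?_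
    rw [Expr.eval, Expr.eval, hs.n, hs.k₂]
  · push Not
    tauto

/-- The program for the first convention. -/
def mainCmd : Cmd := .seq prepare (.seq computePower search)

/-- The program for the second convention. -/
def mainCmdAllowingEmpty : Cmd := .seq mainCmd tryEmpty

theorem params_of_prepare (x : Inst) (s : Store) :
    Params x (computePower.run x.encode (prepare.run x.encode s)) := by
  obtain ⟨-, h1, h2, h3, h4, h5, -⟩ := prepare_spec x s
  exact computePower_spec h1 h2 h3 h4 h5

theorem mainCmd_spec (x : Inst) (s : Store) :
    Tells ((mainCmd.run x.encode s).reg 0) (SearchSucceeds x.D.Adj x.rounds x.k₂ x.width) := by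
  refine search_spec (params_of_prepare x s) ?_
  rw [Cmd.run_reg _ _ (by decide)]
  exact (prepare_spec x s).1

theorem mainCmdAllowingEmpty_spec (x : Inst) (s : Store) :
    Tells ((mainCmdAllowingEmpty.run x.encode s).reg 0)
      (SearchSucceeds x.D.Adj x.rounds x.k₂ x.width ∨
        (x.k₁ = 0 ∧ x.k₂ ≤ x.n ∧ ∀ v, ∃ w, x.D.Adj v w)) := by
  refine tryEmpty_spec ((params_of_prepare x s).run search (by decide)) ?_ (mainCmd_spec x s)
  rw [mainCmd, Cmd.run_seq, Cmd.run_seq, Cmd.run_reg _ _ (by decide), Cmd.run_reg _ _ (by decide)]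
  exact (prepare_spec x s).2.2.2.2.2.2

/-! ### The running time -/

/-- The bound for the numbers in the computation that depend on the parameter. -/
def paramBound (k : ℕ) : ℕ := (6 * k + 1) ^ k + (6 * k + 1) + 1

theorem rounds_le (x : Inst) : x.rounds ≤ max x.k₁ x.k₂ :=
  (Nat.sub_le _ _).trans (le_max_left _ _)

theorem width_le (x : Inst) : x.width ≤ 6 * max x.k₁ x.k₂ + 1 := by
  have h1 := rounds_le x
  have h2 := le_max_right x.k₁ x.k₂
  rw [Inst.width]
  omega

theorem width_pow_rounds_le (x : Inst) :
    x.width ^ x.rounds ≤ (6 * max x.k₁ x.k₂ + 1) ^ max x.k₁ x.k₂ :=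
  (Nat.pow_le_pow_left (width_le x) _).trans (Nat.pow_le_pow_right (by omega) (rounds_le x))

/-- A cost that is polynomial in the length of the input and in the bound on the parameter. -/
def IsTractableCost (f : Inst → ℕ) : Prop :=
  ∃ A d, ∀ x : Inst, f x ≤ A * (paramBound (max x.k₁ x.k₂) * x.encode.length) ^ d

theorem lt_length_encode (x : Inst) : x.n < x.encode.length := by
  rw [Inst.length_encode]
  nlinarith [Nat.le_mul_self x.n]

theorem IsTractableCost.add {f g : Inst → ℕ} (hf : IsTractableCost f) (hg : IsTractableCost g) :
    IsTractableCost fun x => f x + g x := by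
  obtain ⟨A, d, hf⟩ := hf
  obtain ⟨B, e, hg⟩ := hg
  refine ⟨A + B, d + e, fun x => ?_⟩
  have hpos : 0 < paramBound (max x.k₁ x.k₂) * x.encode.length :=
    Nat.mul_pos (Nat.succ_pos _) (Nat.zero_lt_of_lt (lt_length_encode x))
  rw [add_mul]
  exact add_le_add
    ((hf x).trans (Nat.mul_le_mul_left _ (Nat.pow_le_pow_right hpos (Nat.le_add_right _ _))))
    ((hg x).trans (Nat.mul_le_mul_left _ (Nat.pow_le_pow_right hpos (Nat.le_add_left _ _))))

/-- The sum `n + paramBound k` is at most `paramBound k * (n + 1)`, since `paramBound k ≥ 1`, and `n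
+ 1` is at most the input length. This turns a polynomial in the registers into a factor depending
on `k` times a power of the length. -/
theorem isTractableCost_of_boundedBy (W : List ℕ) {c : Cmd} (hc : c.boundedBy W = true)
    {σ : Inst → Store} (hσ : ∀ x, ∀ y ∈ W, (σ x).reg y + 1 ≤ x.n + paramBound (max x.k₁ x.k₂)) :
    IsTractableCost fun x => c.cost x.encode (σ x) := by
  obtain ⟨A, d, h⟩ := Cmd.polyCost hc
  refine ⟨A, d, fun x => ?_⟩
  refine (h x.encode (x.n + paramBound (max x.k₁ x.k₂) - 1) (σ x) fun y hy => ?_).trans ?_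
  · have := hσ x y hy
    omega
  · apply Nat.mul_le_mul_left
    apply Nat.pow_le_pow_left
    have hB : 1 ≤ paramBound (max x.k₁ x.k₂) := Nat.le_add_left _ _
    calc x.n + paramBound (max x.k₁ x.k₂) - 1 + 1 = x.n + paramBound (max x.k₁ x.k₂) := by omega
      _ ≤ paramBound (max x.k₁ x.k₂) * (x.n + 1) := by nlinarith
      _ ≤ _ := Nat.mul_le_mul_left _ (lt_length_encode x)

/-- Only registers that bound loops are listed; `k₂` in register `3` is merely compared with. -/
theorem Params.reg_lt (h : Params x s) {y : ℕ} (hy : y ∈ [1, 2, 4, 5]) :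
    s.reg y + 1 ≤ x.n + paramBound (max x.k₁ x.k₂) := by
  have h2 := rounds_le x
  have h4 := width_le x
  have h5 := width_pow_rounds_le x
  simp only [List.mem_cons, List.not_mem_nil, or_false] at hy
  rw [paramBound]
  rcases hy with rfl | rfl | rfl | rfl
  · rw [h.n]; omega
  · rw [h.rounds]; omega
  · rw [h.width]; omega
  · rw [h.total]; omega

theorem isTractableCost_mainCmd :
    IsTractableCost fun x => mainCmd.cost x.encode (initialStore x.encode) := by
  refine (isTractableCost_of_boundedBy [] (c := prepare) (by decide) (by simp)).add
    ((isTractableCost_of_boundedBy [2, 4] (c := computePower) (by decide) fun x y hy => ?_).add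
      (isTractableCost_of_boundedBy [1, 2, 4, 5] (c := search) (by decide) fun x y hy =>
        (params_of_prepare x _).reg_lt hy))
  -- `computePower` changes register `5` but not its loop bounds in registers `2` and `4`, so their
  -- estimates after it also hold before it.
  have h := (params_of_prepare x (initialStore x.encode)).reg_lt (y := y) (by
    simp only [List.mem_cons, List.not_mem_nil, or_false] at hy ⊢
    tauto)
  rwa [Cmd.run_reg _ _ (by
    simp only [List.mem_cons, List.not_mem_nil, or_false] at hy
    rcases hy with rfl | rfl <;> decide)] at h

theorem isTractableCost_mainCmdAllowingEmpty :
    IsTractableCost fun x => mainCmdAllowingEmpty.cost x.encode (initialStore x.encode) :=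
  isTractableCost_mainCmd.add
    (isTractableCost_of_boundedBy [1, 2, 4, 5] (c := tryEmpty) (by decide) fun x _ hy =>
      ((params_of_prepare x _).run search (by decide)).reg_lt hy)

theorem computable_time (A d : ℕ) : Computable fun k => A * paramBound k ^ d := by
  have hpow : Primrec₂ ((· ^ ·) : ℕ → ℕ → ℕ) := Primrec₂.unpaired'.1 Nat.Primrec.pow
  have hlin : Primrec fun k : ℕ => 6 * k + 1 :=
    Primrec.succ.comp (Primrec.nat_mul.comp (Primrec.const 6) Primrec.id)
  have hbound : Primrec paramBound :=
    Primrec.succ.comp (Primrec.nat_add.comp (hpow.comp hlin Primrec.id) hlin)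
  exact (Primrec.nat_mul.comp (Primrec.const A) (hpow.comp hbound (Primrec.const d))).to_comp

/-- A command that tells the answer within a tractable cost shows fixed-parameter tractability. -/
theorem exists_program_of_cmd {c : Cmd} {p : Inst → Prop}
    (hspec : ∀ x, Tells ((c.run x.encode (initialStore x.encode)).reg 0) (p x))
    (hcost : IsTractableCost fun x => c.cost x.encode (initialStore x.encode)) :
    ∃ (P : Program) (f : ℕ → ℕ) (e : ℕ), Computable f ∧ ∀ x : Inst,
      (p x → OutputsWithin P x.encode (f (max x.k₁ x.k₂) * x.encode.length ^ e) 1) ∧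
      (¬ p x → OutputsWithin P x.encode (f (max x.k₁ x.k₂) * x.encode.length ^ e) 0) := by
  obtain ⟨A, d, h⟩ := hcost
  refine ⟨c.code 0 0, fun k => A * paramBound k ^ d, d, computable_time A d, fun x => ?_⟩
  have hout := c.outputsWithin x.encode
    (t := A * paramBound (max x.k₁ x.k₂) ^ d * x.encode.length ^ d)
    ((h x).trans_eq (by rw [mul_pow, mul_assoc]))
  rcases hspec x with ⟨h1, h2⟩ | ⟨h1, h2⟩
  · rw [h1] at hout
    exact ⟨fun _ => hout, fun h => absurd h2 h⟩
  · rw [h1] at hout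
    exact ⟨fun h => absurd h h2, fun _ => hout⟩

end Final

end InBranchingPartition

theorem corollary7 :
    InBranchingPartition.partitionProblem.IsFPT ∧
      InBranchingPartition.partitionProblemAllowingEmpty.IsFPT := by
  open InBranchingPartition in
  exact ⟨exists_program_of_cmd (fun x => (mainCmd_spec x _).congr (isYes_iff x).symm)
      isTractableCost_mainCmd,
    exists_program_of_cmd
      (fun x => (mainCmdAllowingEmpty_spec x _).congr (isYes_allowingEmpty_iff x).symm)
      isTractableCost_mainCmdAllowingEmpty⟩
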